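/- Let $L_1,L_3>0$ and $\Omega=\mathbb T_{L_1}\times[-1/2,1/2]\times\mathbb T_{L_3}$. For a viscosity $\nu>0$ let $U$ and $u$ be divergence-free velocity fields on $(0,\infty)\times\Omega$ with the Couette boundary values $$U=u=-\tfrac12 e_1 \ \text{ at } x_2=-\tfrac12,\qquad U=u=\tfrac12 e_1\ \text{ at } x_2=\tfrac12$$ (in the sense of traces, for a.e. $t$), and with the same initial value $u_0\in H^1(\Omega)$, attained in $L^2(\Omega)$ as $t\to0^+$. Here $U\in L^2_{\mathrm{loc}}([0,\infty);H^1(\Omega))\cap L^\infty([0,\infty)\times\Omega)$ is the advecting field and $u\in L^\infty([0,\infty);H^1(\Omega))\cap L^2_{\mathrm{loc}}([0,\infty);H^2(\Omega))$ is the strong solution of $$\partial_t u+U\cdot\nabla u=-\nabla p+\nu\Delta u,\qquad \nabla\cdot u=0,$$ that is, $\partial_t u\in L^2_{\mathrm{loc}}([0,\infty);L^2(\Omega))$, $p\in L^2_{\mathrm{loc}}([0,\infty);H^1(\Omega))$ and the equation holds almost everywhere. Put $$\langle g\rangle=\limsup_{T\to\infty}\frac1T\int_0^T\frac1{|\Omega|}\int_\Omega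 g\,dx\,dt,\qquad \varepsilon_U=\nu\langle|\nabla U|^2\rangle,\qquad \varepsilon_u=\nu\langle|\nabla u|^2\rangle,$$ with values in $[0,\infty]$. (1) If $0<\nu\le 8$, then $\varepsilon_u\le 4\,\varepsilon_U^{1/3}$. (2) Let $\alpha,\beta\in\mathbb R$ and $c_1,c_2>0$. There is a constant $c>0$, depending only on $\alpha,\beta,c_1,c_2$, such that the following holds for all $L_1,L_3>0$ and $0<\nu_0\le1$. If $\{U_\nu\}_{0<\nu<\nu_0}$ is a family of advecting fields as above, with corresponding solutions $\{u_\nu\}_{0<\nu<\nu_0}$ (for the viscosity $\nu$), and $$c_1\,\nu^\alpha(\log\nu^{-1})^\beta\le\nu\langle|\nabla U_\nu|^2\rangle\le c_2\,\nu^\alpha(\log\nu^{-1})^\beta\qquad\text{for all }\nu\in(0,\nu_0),$$ then $$\nu\langle|\nabla u_\nu|^2\rangle\le c\,\nu^{\alpha/3}(\log\nu^{-1})^{\beta/3}\qquad\text{for all }\nu\in(0,\nu_0).$$ -/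

import Mathlib

open MeasureTheory Set Filter Topology
open scoped ENNReal NNReal ContDiff

noncomputable section

namespace Couette

/-- Points `x = (x₁, x₂, x₃)`; the coordinates are `x 0`, `x 1`, `x 2`, and `x 1` is the
wall-normal one. -/
abbrev Space : Type := Fin 3 → ℝ

/-- A time-dependent scalar field, `f t x`. -/
abbrev ScalarField : Type := ℝ → Space → ℝ

/-- A time-dependent vector field; `u i t x` is the `i`-th component. -/
abbrev VectorField : Type := Fin 3 → ScalarField

/-- A time-dependent matrix field; for a gradient, `D i j t x` is `∂ⱼ uᵢ (t, x)`. -/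
abbrev MatrixField : Type := Fin 3 → Fin 3 → ScalarField

/-- The fundamental cell `[0, L₁] × [-1/2, 1/2] × [0, L₃]` of the channel
`𝕋_{L₁} × [-1/2, 1/2] × 𝕋_{L₃}`. A (class of a) function on the channel is represented by its
values on this cell; periodicity enters through the test functions. -/
def cell (L₁ L₃ : ℝ) : Set Space := Icc ![0, -1 / 2, 0] ![L₁, 1 / 2, L₃]

/-- Lebesgue measure on the channel. -/
def chan (L₁ L₃ : ℝ) : Measure Space := volume.restrict (cell L₁ L₃)

/-- Lebesgue measure on `(0, ∞) × Ω`. -/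
def spaceTime (L₁ L₃ : ℝ) : Measure (ℝ × Space) :=
  (volume.restrict (Ioi (0 : ℝ))).prod (chan L₁ L₃)

/-- The classical partial derivative `∂ⱼ φ`. -/
def partialDeriv (j : Fin 3) (φ : Space → ℝ) (x : Space) : ℝ := fderiv ℝ φ x (Pi.single j 1)

/-- `C_c^∞` functions on the open channel `𝕋_{L₁} × (-1/2, 1/2) × 𝕋_{L₃}`. -/
structure IsTest (L₁ L₃ : ℝ) (φ : Space → ℝ) : Prop where
  smooth : ContDiff ℝ ∞ φ
  periodic₁ : ∀ x, φ (x + Pi.single 0 L₁) = φ x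
  periodic₃ : ∀ x, φ (x + Pi.single 2 L₃) = φ x
  support : ∃ r < (1 / 2 : ℝ), ∀ x, φ x ≠ 0 → |x 1| ≤ r

/-- `C_c^∞` functions on `(0, ∞) × 𝕋_{L₁} × (-1/2, 1/2) × 𝕋_{L₃}`. -/
structure IsSpaceTimeTest (L₁ L₃ : ℝ) (η : ℝ × Space → ℝ) : Prop where
  smooth : ContDiff ℝ ∞ η
  periodic₁ : ∀ t x, η (t, x + Pi.single 0 L₁) = η (t, x)
  periodic₃ : ∀ t x, η (t, x + Pi.single 2 L₃) = η (t, x)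
  support : ∃ a b r : ℝ, 0 < a ∧ r < 1 / 2 ∧ ∀ t x, η (t, x) ≠ 0 → t ∈ Icc a b ∧ |x 1| ≤ r

/-- `g` is the weak gradient of `f` on the channel. -/
def HasWeakGrad (L₁ L₃ : ℝ) (f : Space → ℝ) (g : Fin 3 → Space → ℝ) : Prop :=
  ∀ φ, IsTest L₁ L₃ φ → ∀ j,
    ∫ x, f x * partialDeriv j φ x ∂(chan L₁ L₃) = -∫ x, g j x * φ x ∂(chan L₁ L₃)

/-- `f ∈ H¹(Ω)`, with weak gradient `g`. -/
def MemH1 (L₁ L₃ : ℝ) (f : Space → ℝ) (g : Fin 3 → Space → ℝ) : Prop :=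
  MemLp f 2 (chan L₁ L₃) ∧ (∀ j, MemLp (g j) 2 (chan L₁ L₃)) ∧ HasWeakGrad L₁ L₃ f g

/-- `f ∈ H¹₀(Ω)`, with weak gradient `g`: `(f, g)` lies in the `H¹`-closure of the test
functions. -/
def MemH10 (L₁ L₃ : ℝ) (f : Space → ℝ) (g : Fin 3 → Space → ℝ) : Prop :=
  MemH1 L₁ L₃ f g ∧ ∀ ε : ℝ≥0∞, 0 < ε → ∃ φ, IsTest L₁ L₃ φ ∧
    eLpNorm (fun x => f x - φ x) 2 (chan L₁ L₃) ≤ ε ∧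
    ∀ j, eLpNorm (fun x => g j x - partialDeriv j φ x) 2 (chan L₁ L₃) ≤ ε

/-- `f ∈ L²(0, T; L²(Ω))` for every `T > 0`. -/
def MemL2LocL2 (L₁ L₃ : ℝ) (f : ScalarField) : Prop :=
  ∀ T : ℝ, 0 < T → MemLp (fun z : ℝ × Space => f z.1 z.2) 2
    ((volume.restrict (Ioc (0 : ℝ) T)).prod (chan L₁ L₃))

/-- `f ∈ L²(0, T; H¹(Ω))` for every `T > 0`, with spatial weak gradient `g`. -/
def MemL2LocH1 (L₁ L₃ : ℝ) (f : ScalarField) (g : Fin 3 → ScalarField) : Prop :=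
  MemL2LocL2 L₁ L₃ f ∧ (∀ j, MemL2LocL2 L₁ L₃ (g j)) ∧
    ∀ᵐ t ∂(volume.restrict (Ioi (0 : ℝ))), HasWeakGrad L₁ L₃ (f t) (fun j => g j t)

/-- `g` is the weak time derivative of `f` on `(0, ∞) × Ω`. -/
def HasWeakTimeDeriv (L₁ L₃ : ℝ) (f g : ScalarField) : Prop :=
  ∀ η, IsSpaceTimeTest L₁ L₃ η →
    ∫ z, f z.1 z.2 * deriv (fun s => η (s, z.2)) z.1 ∂(spaceTime L₁ L₃) =
      -∫ z, g z.1 z.2 * η z ∂(spaceTime L₁ L₃)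

/-- The components of the laminar profile `x₂ e₁`, which equals `± e₁ / 2` on the walls
`x₂ = ± 1/2`. -/
def laminar (i : Fin 3) (x : Space) : ℝ := if i = 0 then x 1 else 0

/-- The (constant) gradient of `x₂ e₁`. -/
def laminarGrad (i j : Fin 3) : ℝ := if i = 0 ∧ j = 1 then 1 else 0

/-- The field `u`, with spatial gradient `Du`, equals `- e₁ / 2` on the wall `x₂ = - 1/2` and
`e₁ / 2` on the wall `x₂ = 1/2`, in the sense of traces: `u(t) - x₂ e₁ ∈ H¹₀(Ω)` for a.e. `t`. -/
def HasCouetteBoundaryValues (L₁ L₃ : ℝ) (u : VectorField) (Du : MatrixField) : Prop :=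
  ∀ᵐ t ∂(volume.restrict (Ioi (0 : ℝ))), ∀ i,
    MemH10 L₁ L₃ (fun x => u i t x - laminar i x) (fun j x => Du i j t x - laminarGrad i j)

/-- The divergence vanishes, in terms of the spatial gradient `Du`. -/
def IsDivFree (L₁ L₃ : ℝ) (Du : MatrixField) : Prop :=
  ∀ᵐ z ∂(spaceTime L₁ L₃), ∑ i, Du i i z.1 z.2 = 0

/-- `u(t) → u₀` in `L²(Ω)` as `t → 0⁺`. -/
def HasInitialValue (L₁ L₃ : ℝ) (u : VectorField) (u₀ : Fin 3 → Space → ℝ) : Prop :=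
  ∀ i, Tendsto (fun t => eLpNorm (fun x => u i t x - u₀ i x) 2 (chan L₁ L₃)) (𝓝[>] 0) (𝓝 0)

/-- `U`, with spatial gradient `DU`, is an admissible advecting field:
`U ∈ L²_loc([0, ∞); H¹(Ω)) ∩ L^∞([0, ∞) × Ω)`, divergence free, with the Couette boundary
values. -/
structure IsAdvectingField (L₁ L₃ : ℝ) (U : VectorField) (DU : MatrixField) : Prop where
  memL2LocH1 : ∀ i, MemL2LocH1 L₁ L₃ (U i) (DU i)
  bounded : ∃ M : ℝ, ∀ i, ∀ᵐ z ∂(spaceTime L₁ L₃), |U i z.1 z.2| ≤ M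
  divFree : IsDivFree L₁ L₃ DU
  boundary : HasCouetteBoundaryValues L₁ L₃ U DU

/-- `u`, with spatial gradient `Du`, is a strong solution of
`∂ₜ u + U · ∇u = -∇p + ν Δu`, `∇ · u = 0` with the Couette boundary values:
`u ∈ L^∞([0, ∞); H¹(Ω)) ∩ L²_loc([0, ∞); H²(Ω))`, `∂ₜ u ∈ L²_loc([0, ∞); L²(Ω))`,
`p ∈ L²_loc([0, ∞); H¹(Ω))`, and the momentum equation holds a.e. in `(0, ∞) × Ω`. -/
structure IsStrongSolution (L₁ L₃ ν : ℝ) (U u : VectorField) (Du : MatrixField) : Prop where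
  memL2LocH1 : ∀ i, MemL2LocH1 L₁ L₃ (u i) (Du i)
  boundedH1 : ∃ M : ℝ≥0, ∀ᵐ t ∂(volume.restrict (Ioi (0 : ℝ))), ∀ i,
    eLpNorm (u i t) 2 (chan L₁ L₃) ≤ M ∧ ∀ j, eLpNorm (Du i j t) 2 (chan L₁ L₃) ≤ M
  divFree : IsDivFree L₁ L₃ Du
  boundary : HasCouetteBoundaryValues L₁ L₃ u Du
  momentum : ∃ (dtu : VectorField) (D2u : Fin 3 → MatrixField) (p : ScalarField)
      (Dp : VectorField),
    (∀ i, MemL2LocL2 L₁ L₃ (dtu i) ∧ HasWeakTimeDeriv L₁ L₃ (u i) (dtu i)) ∧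
    (∀ i j, MemL2LocH1 L₁ L₃ (Du i j) (D2u i j)) ∧
    MemL2LocH1 L₁ L₃ p Dp ∧
    ∀ i, ∀ᵐ z ∂(spaceTime L₁ L₃),
      dtu i z.1 z.2 + ∑ j, U j z.1 z.2 * Du i j z.1 z.2 =
        -Dp i z.1 z.2 + ν * ∑ j, D2u i j j z.1 z.2

/-- The Couette setting: `U` is an admissible advecting field, `u` is the advected field, and
both start from the same `u₀ ∈ H¹(Ω)`. -/
structure IsCouettePair (L₁ L₃ ν : ℝ) (U : VectorField) (DU : MatrixField) (u : VectorField)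
    (Du : MatrixField) : Prop where
  advecting : IsAdvectingField L₁ L₃ U DU
  solution : IsStrongSolution L₁ L₃ ν U u Du
  initial : ∃ (u₀ : Fin 3 → Space → ℝ) (Du₀ : Fin 3 → Fin 3 → Space → ℝ),
    (∀ i, MemH1 L₁ L₃ (u₀ i) (Du₀ i)) ∧
    HasInitialValue L₁ L₃ U u₀ ∧ HasInitialValue L₁ L₃ u u₀

/-- The long-time volume average
`⟨g⟩ = limsup_{T → ∞} (1/T) ∫₀ᵀ (1/|Ω|) ∫_Ω g dx dt` of a nonnegative quantity, in `[0, ∞]`. -/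
def longTimeAverage (L₁ L₃ : ℝ) (g : ℝ → Space → ℝ≥0∞) : ℝ≥0∞ :=
  limsup (fun T : ℝ => (ENNReal.ofReal T)⁻¹ * ∫⁻ t in Ioc (0 : ℝ) T,
    (volume (cell L₁ L₃))⁻¹ * ∫⁻ x in cell L₁ L₃, g t x) atTop

/-- The energy dissipation `ν ⟨|∇u|²⟩`, where `|∇u|² = ∑ᵢⱼ (∂ⱼ uᵢ)²`. -/
def dissipation (L₁ L₃ ν : ℝ) (Du : MatrixField) : ℝ≥0∞ :=
  ENNReal.ofReal ν *
    longTimeAverage L₁ L₃ (fun t x => ENNReal.ofReal (∑ i, ∑ j, Du i j t x ^ 2))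

end Couette

end

/-! ### Test functions, H¹₀ approximation and integration by parts on the channel -/

namespace Couette

variable {L₁ L₃ : ℝ}

/-! The proof is the background method, with the advecting field kept separate from the advected
one. Choose a smooth ψ(x₂) vanishing near the walls with ψ' ≤ 1, and test the momentum equation on a
time slice with v = u - (x₂ - ψ)e₁, which lies in H¹₀. The pressure drops out and transport by U is
antisymmetric on H¹₀, so the only convective term left is ∫(1 - ψ')U₂v₁ (`integral_momentum`). Since
U₂ has zero integral against every smooth function of x₂ alone (`integral_wallNormal_mul_eq_zero`),
v₁ may be replaced there by w₁ = u₁ - x₂.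

Both U₂ and w₁ vanish on the walls, so on each wall-normal line their squares are bounded by the
distance to the wall times the integral of the squared normal derivative. Integrated against 1 - ψ'
≥ 0 this gives the factor `layerWeight ψ` (`MemH10.integral_weight_mul_sq_le`), which is O(δ) when
the background x₂ - ψ varies only in a layer of width δ. Young's inequality with parameter q splits
the product into the gradient energy of u - x₂e₁, which viscosity absorbs, and that of U - x₂e₁,
which is where ε_U enters (`background_inequality`).

In time, the work of ∂ₜu against v is a difference of kinetic energies, hence bounded below
uniformly in T (`exists_neg_le_integral_timeDeriv_mul`), and this bound disappears after division by
T. The outcome is `IsCouettePair.dissipation_le`: ε_u ≤ ν + 2νcI + w/(2qν)·(ε_U - ν), where I bounds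
∫ψ'² and w bounds the layer weight.

For a layer of width δ (`exists_boundary_layer`), νI is of order ν/δ and w/(qν) of order δ²/ν², so δ
= ν/ε_U^{1/3} makes both contributions of order ε_U^{1/3}. If ε_U^{1/3} ≤ 4ν this δ is at least 1/4;
there the laminar background ψ = 0 suffices, and ν ≤ 8 enters. The second claim is the first one at
each ν combined with the assumed upper bound on ε_U. -/

lemma isCompact_cell : IsCompact (cell L₁ L₃) := isCompact_Icc

lemma measurableSet_cell : MeasurableSet (cell L₁ L₃) := measurableSet_Icc

instance : IsFiniteMeasure (chan L₁ L₃) :=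
  ⟨by rw [chan, Measure.restrict_apply_univ]; exact isCompact_cell.measure_lt_top⟩

lemma memLp_of_continuous {f : Space → ℝ} (hf : Continuous f) (p : ℝ≥0∞) :
    MemLp f p (chan L₁ L₃) := by
  obtain ⟨C, hC⟩ := isCompact_cell.exists_bound_of_continuousOn (s := cell L₁ L₃) hf.continuousOn
  exact MemLp.of_bound hf.aestronglyMeasurable C
    (ae_restrict_of_forall_mem measurableSet_cell hC)

lemma continuous_partialDeriv {φ : Space → ℝ} (hφ : ContDiff ℝ ∞ φ) (j : Fin 3) :
    Continuous (partialDeriv j φ) :=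
  (hφ.continuous_fderiv (by simp)).clm_apply continuous_const

lemma partialDeriv_mul {φ ψ : Space → ℝ} (hφ : ContDiff ℝ ∞ φ) (hψ : ContDiff ℝ ∞ ψ) (j : Fin 3)
    (x : Space) : partialDeriv j (fun x => φ x * ψ x) x =
      partialDeriv j φ x * ψ x + φ x * partialDeriv j ψ x := by
  unfold partialDeriv
  rw [fderiv_fun_mul (hφ.differentiable (by simp) x) (hψ.differentiable (by simp) x)]
  simp; ring

/-- A smooth function which is periodic in the two tangential directions. -/
structure IsPeriodicSmooth (L₁ L₃ : ℝ) (φ : Space → ℝ) : Prop where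
  smooth : ContDiff ℝ ∞ φ
  periodic₁ : ∀ x, φ (x + Pi.single 0 L₁) = φ x
  periodic₃ : ∀ x, φ (x + Pi.single 2 L₃) = φ x

lemma IsTest.isPeriodicSmooth {φ : Space → ℝ} (h : IsTest L₁ L₃ φ) : IsPeriodicSmooth L₁ L₃ φ :=
  ⟨h.smooth, h.periodic₁, h.periodic₃⟩

lemma isPeriodicSmooth_wallNormal {Z : ℝ → ℝ} (hZ : ContDiff ℝ ∞ Z) :
    IsPeriodicSmooth L₁ L₃ (fun x => Z (x 1)) :=
  ⟨hZ.comp (contDiff_apply ℝ ℝ (1 : Fin 3)), fun x => by simp, fun x => by simp⟩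

lemma IsTest.mul {φ ψ : Space → ℝ} (hφ : IsTest L₁ L₃ φ) (hψ : IsPeriodicSmooth L₁ L₃ ψ) :
    IsTest L₁ L₃ (fun x => φ x * ψ x) where
  smooth := hφ.smooth.mul hψ.smooth
  periodic₁ x := by rw [hφ.periodic₁, hψ.periodic₁]
  periodic₃ x := by rw [hφ.periodic₃, hψ.periodic₃]
  support := by
    obtain ⟨r, hr, h⟩ := hφ.support
    exact ⟨r, hr, fun x hx => h x (left_ne_zero_of_mul hx)⟩

lemma partialDeriv_wallNormal {Z : ℝ → ℝ} (hZ : ContDiff ℝ ∞ Z) (j : Fin 3) (x : Space) :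
    partialDeriv j (fun x => Z (x 1)) x = if j = 1 then deriv Z (x 1) else 0 := by
  have h1 : HasFDerivAt (fun x : Space => x 1)
      (ContinuousLinearMap.proj (R := ℝ) (φ := fun _ : Fin 3 => ℝ) 1) x :=
    hasFDerivAt_apply 1 x
  have h2 := ((hZ.differentiable (by simp)) (x 1)).hasDerivAt.comp_hasFDerivAt x h1
  have h3 : (fun x : Space => Z (x 1)) = Z ∘ (fun x : Space => x 1) := rfl
  unfold partialDeriv
  rw [h3, h2.fderiv]
  fin_cases j <;> simp

/-- Divergence theorem on the cell for the field whose only nonzero component is the j-th one, equal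
to φ. The two opposite faces cancel by periodicity in the tangential directions; in the wall-normal
direction φ vanishes on both. -/
lemma integral_partialDeriv_eq_zero (h₁ : 0 < L₁) (h₃ : 0 < L₃) {φ : Space → ℝ}
    (hφ : IsTest L₁ L₃ φ) (j : Fin 3) : ∫ x, partialDeriv j φ x ∂(chan L₁ L₃) = 0 := by
  have hle : (![0, -1 / 2, 0] : Space) ≤ ![L₁, 1 / 2, L₃] := by
    intro i; fin_cases i <;> simp <;> linarith
  have hd : ∀ x, HasFDerivAt φ (fderiv ℝ φ x) x :=
    fun x => (hφ.smooth.differentiable (by simp) x).hasFDerivAt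
  have hsum : ∀ x : Space, (∑ i, (if i = j then fderiv ℝ φ x else 0) (Pi.single i 1)) =
      partialDeriv j φ x := fun x => by
    rw [Finset.sum_eq_single j (fun b _ hb => by simp [hb]) (by simp)]
    simp [partialDeriv]
  have key := integral_divergence_of_hasFDerivAt_off_countable' (E := ℝ) (n := 2) _ _ hle
    (fun i x => if i = j then φ x else 0) (fun i x => if i = j then fderiv ℝ φ x else 0)
    ∅ countable_empty
    (fun i => by
      by_cases h : i = j
      · simpa [h] using hφ.smooth.continuous.continuousOn
      · simpa [h] using continuousOn_const)
    (fun x _ i => by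
      by_cases h : i = j
      · simpa [h] using hd x
      · simpa [h] using hasFDerivAt_const (0 : ℝ) x)
    (by
      simp only [hsum]
      exact (continuous_partialDeriv hφ.smooth j).integrableOn_Icc)
  simp only [hsum] at key
  rw [chan, cell, key, Finset.sum_eq_single j (fun b _ hb => by simp [hb]) (by simp), ← integral_sub]
  rotate_left
  · simp only [if_true]
    exact Continuous.integrableOn_Icc (hφ.smooth.continuous.comp (by fun_prop))
  · simp only [if_true]
    exact Continuous.integrableOn_Icc (hφ.smooth.continuous.comp (by fun_prop))
  · refine integral_eq_zero_of_ae (Eventually.of_forall fun y => ?_)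
    simp only [if_true, Pi.zero_apply]
    obtain ⟨r, hr, hs⟩ := hφ.support
    fin_cases j
    · refine sub_eq_zero.2 (Eq.trans (congrArg φ ?_)
        (hφ.periodic₁ (Fin.insertNth (α := fun _ => ℝ) 0 (0 : ℝ) y)))
      ext i; fin_cases i <;> simp [Fin.insertNth, Fin.succAboveCases]
      all_goals rfl
    · have h0 : ∀ c : ℝ, r < |c| → φ (Fin.insertNth (1 : Fin 3) c y) = 0 := by
        intro c hc
        by_contra hne
        have := hs _ hne
        simp at this
        linarith
      have e1 := h0 (1 / 2) (by rw [abs_of_pos] <;> linarith)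
      have e2 := h0 (-1 / 2) (by rw [abs_of_neg] <;> linarith)
      exact sub_eq_zero.2 (e1.trans e2.symm)
    · refine sub_eq_zero.2 (Eq.trans (congrArg φ ?_)
        (hφ.periodic₃ (Fin.insertNth (α := fun _ => ℝ) 2 (0 : ℝ) y)))
      ext i; fin_cases i <;> simp [Fin.insertNth, Fin.succAboveCases]

lemma integrable_of_continuous {f : Space → ℝ} (hf : Continuous f) :
    Integrable f (chan L₁ L₃) := (memLp_of_continuous hf 1).integrable le_rfl

/-- The product of Z with a test function is again a test function, so Z may be arbitrary at the
walls. -/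
lemma IsPeriodicSmooth.hasWeakGrad (h₁ : 0 < L₁) (h₃ : 0 < L₃) {Z : Space → ℝ}
    (hZ : IsPeriodicSmooth L₁ L₃ Z) : HasWeakGrad L₁ L₃ Z (fun j => partialDeriv j Z) := by
  intro φ hφ j
  have h := integral_partialDeriv_eq_zero h₁ h₃ (hφ.mul hZ) j
  simp only [partialDeriv_mul hφ.smooth hZ.smooth] at h
  have c1 := continuous_partialDeriv hφ.smooth j
  have c2 := continuous_partialDeriv hZ.smooth j
  have c3 := hφ.smooth.continuous
  have c4 := hZ.smooth.continuous
  have h' := integral_add (integrable_of_continuous (L₁ := L₁) (L₃ := L₃) (c1.mul c4))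
    (integrable_of_continuous (c3.mul c2))
  simp only [Pi.mul_apply] at h'
  rw [h'] at h
  simp only [mul_comm (Z _), mul_comm (partialDeriv j Z _)]
  linarith

lemma memLp_continuous_mul {ρ f : Space → ℝ} (hf : MemLp f 2 (chan L₁ L₃)) (hρ : Continuous ρ) :
    MemLp (fun x => ρ x * f x) 2 (chan L₁ L₃) :=
  MeasureTheory.MemLp.mul (p := ∞) (q := 2) (r := 2) hf (memLp_of_continuous hρ ∞)

section L2

variable {α : Type*} [MeasurableSpace α] {μ : Measure α}

lemma eLpNorm_one_mul_le {f g : α → ℝ} (hf : MemLp f 2 μ) (hg : MemLp g 2 μ) :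
    eLpNorm (fun x => f x * g x) 1 μ ≤ eLpNorm f 2 μ * eLpNorm g 2 μ :=
  eLpNorm_smul_le_mul_eLpNorm (p := 2) (q := 2) (r := 1) (φ := f) (f := g) hg.1 hf.1

/-- Strong convergence in `L²`. -/
structure TendstoL2 (μ : Measure α) (a : ℕ → α → ℝ) (b : α → ℝ) : Prop where
  memLp : ∀ n, MemLp (a n) 2 μ
  memLp_lim : MemLp b 2 μ
  tendsto : Tendsto (fun n => eLpNorm (fun x => b x - a n x) 2 μ) atTop (𝓝 0)

lemma TendstoL2.const {b : α → ℝ} (hb : MemLp b 2 μ) : TendstoL2 μ (fun _ => b) b :=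
  ⟨fun _ => hb, hb, by simp⟩

lemma TendstoL2.integral_mul {a b : ℕ → α → ℝ} {a' b' : α → ℝ} (ha : TendstoL2 μ a a')
    (hb : TendstoL2 μ b b') :
    Tendsto (fun n => ∫ x, a n x * b n x ∂μ) atTop (𝓝 (∫ x, a' x * b' x ∂μ)) := by
  have hda n : MemLp (fun x => a' x - a n x) 2 μ := ha.memLp_lim.sub (ha.memLp n)
  have hdb n : MemLp (fun x => b' x - b n x) 2 μ := hb.memLp_lim.sub (hb.memLp n)
  refine tendsto_integral_of_L1' _ (ha.memLp_lim.integrable_mul hb.memLp_lim).1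
    (Eventually.of_forall fun n => (ha.memLp n).integrable_mul (hb.memLp n)) ?_
  have hbound : ∀ n, eLpNorm ((fun x => a n x * b n x) - fun x => a' x * b' x) 1 μ ≤
      eLpNorm (fun x => a' x - a n x) 2 μ * eLpNorm (fun x => b' x - b n x) 2 μ +
      (eLpNorm (fun x => a' x - a n x) 2 μ * eLpNorm b' 2 μ +
        eLpNorm a' 2 μ * eLpNorm (fun x => b' x - b n x) 2 μ) := by
    intro n
    -- Every term on the right contains a factor that tends to 0 in L², so Hölder gives convergence
    -- of the products in L¹.
    have e : ((fun x => a n x * b n x) - fun x => a' x * b' x) =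
        (fun x => (a' x - a n x) * (b' x - b n x)) -
          ((fun x => (a' x - a n x) * b' x) + fun x => a' x * (b' x - b n x)) := by
      ext x; simp; ring
    have m1 : AEStronglyMeasurable (fun x => (a' x - a n x) * (b' x - b n x)) μ :=
      (hda n).1.mul (hdb n).1
    have m2 : AEStronglyMeasurable (fun x => (a' x - a n x) * b' x) μ :=
      (hda n).1.mul hb.memLp_lim.1
    have m3 : AEStronglyMeasurable (fun x => a' x * (b' x - b n x)) μ :=
      ha.memLp_lim.1.mul (hdb n).1
    rw [e]
    refine (eLpNorm_sub_le m1 (m2.add m3) le_rfl).trans (add_le_add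
      (eLpNorm_one_mul_le (hda n) (hdb n)) ((eLpNorm_add_le m2 m3 le_rfl).trans
      (add_le_add (eLpNorm_one_mul_le (hda n) hb.memLp_lim)
        (eLpNorm_one_mul_le ha.memLp_lim (hdb n)))))
  refine tendsto_of_tendsto_of_tendsto_of_le_of_le tendsto_const_nhds ?_ (fun _ => zero_le)
    hbound
  have t1 := ENNReal.Tendsto.mul ha.tendsto (.inr ENNReal.zero_ne_top) hb.tendsto
    (.inr ENNReal.zero_ne_top)
  have t2 := ENNReal.Tendsto.mul_const (b := eLpNorm b' 2 μ) ha.tendsto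
    (.inr hb.memLp_lim.eLpNorm_ne_top)
  have t3 := ENNReal.Tendsto.const_mul (a := eLpNorm a' 2 μ) hb.tendsto
    (.inr ha.memLp_lim.eLpNorm_ne_top)
  simpa using t1.add (t2.add t3)

lemma TendstoL2.bdd_mul {a : ℕ → α → ℝ} {a' ρ : α → ℝ} (ha : TendstoL2 μ a a')
    (hρ : AEStronglyMeasurable ρ μ) {M : ℝ} (hM : ∀ᵐ x ∂μ, |ρ x| ≤ M) :
    TendstoL2 μ (fun n x => ρ x * a n x) (fun x => ρ x * a' x) := by
  have hρ' : MemLp ρ ∞ μ := memLp_top_of_bound hρ M hM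
  refine ⟨fun n => MemLp.mul (p := ∞) (q := 2) (r := 2) (ha.memLp n) hρ',
    MemLp.mul (p := ∞) (q := 2) (r := 2) ha.memLp_lim hρ', ?_⟩
  have hb : ∀ n, eLpNorm (fun x => ρ x * a' x - ρ x * a n x) 2 μ ≤
      eLpNorm ρ ∞ μ * eLpNorm (fun x => a' x - a n x) 2 μ := by
    intro n
    have : (fun x => ρ x * a' x - ρ x * a n x) = ρ • (fun x => a' x - a n x) := by
      ext x; simp; ring
    rw [this]
    exact eLpNorm_smul_le_mul_eLpNorm (p := ∞) (q := 2) (r := 2)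
      (ha.memLp_lim.sub (ha.memLp n)).1 hρ
  refine tendsto_of_tendsto_of_tendsto_of_le_of_le tendsto_const_nhds ?_ (fun _ => zero_le) hb
  simpa using ENNReal.Tendsto.const_mul (a := eLpNorm ρ ∞ μ) ha.tendsto
    (.inr hρ'.eLpNorm_ne_top)

end L2

lemma MemH10.exists_seq {f : Space → ℝ} {g : Fin 3 → Space → ℝ} (h : MemH10 L₁ L₃ f g) :
    ∃ φ : ℕ → Space → ℝ, (∀ n, IsTest L₁ L₃ (φ n)) ∧ TendstoL2 (chan L₁ L₃) φ f ∧
      ∀ j, TendstoL2 (chan L₁ L₃) (fun n => partialDeriv j (φ n)) (g j) := by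
  choose φ h1 h2 h3 using fun n : ℕ => h.2 ((n : ℝ≥0∞) + 1)⁻¹
    (ENNReal.inv_pos.2 (by simp [ENNReal.add_eq_top]))
  have ht : Tendsto (fun n : ℕ => ((n : ℝ≥0∞) + 1)⁻¹) atTop (𝓝 0) := by
    have := (tendsto_add_atTop_iff_nat 1).2 ENNReal.tendsto_inv_nat_nhds_zero
    simpa using this
  refine ⟨φ, h1, ⟨fun n => memLp_of_continuous (h1 n).smooth.continuous 2, h.1.1, ?_⟩,
    fun j => ⟨fun n => memLp_of_continuous (continuous_partialDeriv (h1 n).smooth j) 2,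
      h.1.2.1 j, ?_⟩⟩
  · exact tendsto_of_tendsto_of_tendsto_of_le_of_le tendsto_const_nhds ht (fun _ => zero_le) h2
  · exact tendsto_of_tendsto_of_tendsto_of_le_of_le tendsto_const_nhds ht (fun _ => zero_le)
      fun n => h3 n j

/-- Integration by parts against `H¹₀` functions. -/
lemma HasWeakGrad.integral_mul_eq_neg {f a : Space → ℝ} {g Da : Fin 3 → Space → ℝ}
    (h : HasWeakGrad L₁ L₃ f g) (hf : MemLp f 2 (chan L₁ L₃)) (j : Fin 3)
    (hg : MemLp (g j) 2 (chan L₁ L₃)) (ha : MemH10 L₁ L₃ a Da) :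
    ∫ x, g j x * a x ∂(chan L₁ L₃) = -∫ x, f x * Da j x ∂(chan L₁ L₃) := by
  obtain ⟨φ, h1, h2, h3⟩ := ha.exists_seq
  have t1 := (TendstoL2.const hf).integral_mul (h3 j)
  have t2 := ((TendstoL2.const hg).integral_mul h2).neg
  have := tendsto_nhds_unique t1 (t2.congr fun n => (h (φ n) (h1 n) j).symm)
  linarith

/-- Transport by a bounded divergence-free field is antisymmetric on `H¹₀`. -/
lemma integral_transport_add_eq_zero {U : Fin 3 → Space → ℝ} {DU : Fin 3 → Fin 3 → Space → ℝ}
    {M : ℝ} (hU : ∀ i, MemLp (U i) 2 (chan L₁ L₃)) (hDU : ∀ i j, MemLp (DU i j) 2 (chan L₁ L₃))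
    (hgrad : ∀ i, HasWeakGrad L₁ L₃ (U i) (DU i))
    (hM : ∀ i, ∀ᵐ x ∂(chan L₁ L₃), |U i x| ≤ M)
    (hdiv : ∀ᵐ x ∂(chan L₁ L₃), ∑ i, DU i i x = 0)
    {a b : Space → ℝ} {Da Db : Fin 3 → Space → ℝ} (ha : MemH10 L₁ L₃ a Da)
    (hb : MemH10 L₁ L₃ b Db) :
    ∑ j, ((∫ x, (U j x * Da j x) * b x ∂(chan L₁ L₃)) +
      ∫ x, (U j x * a x) * Db j x ∂(chan L₁ L₃)) = 0 := by
  obtain ⟨φ, h1, h2, h3⟩ := ha.exists_seq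
  obtain ⟨χ, k1, k2, k3⟩ := hb.exists_seq
  have hn : ∀ n, ∑ j, ((∫ x, (U j x * partialDeriv j (φ n) x) * χ n x ∂(chan L₁ L₃)) +
      ∫ x, (U j x * φ n x) * partialDeriv j (χ n) x ∂(chan L₁ L₃)) = 0 := by
    intro n
    have c1 := (h1 n).smooth.continuous
    have c2 := (k1 n).smooth.continuous
    have hI : ∀ j, (∫ x, (U j x * partialDeriv j (φ n) x) * χ n x ∂(chan L₁ L₃)) +
      ∫ x, (U j x * φ n x) * partialDeriv j (χ n) x ∂(chan L₁ L₃) =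
        - ∫ x, DU j j x * (φ n x * χ n x) ∂(chan L₁ L₃) := by
      intro j
      have d1 := continuous_partialDeriv (h1 n).smooth j
      have d2 := continuous_partialDeriv (k1 n).smooth j
      -- The product φχ is itself a test function, so the weak gradient of U_j may be paired with
      -- it; summing over j then produces the divergence of U.
      rw [← hgrad j _ ((h1 n).mul (k1 n).isPeriodicSmooth) j, ← integral_add]
      · refine integral_congr_ae (Eventually.of_forall fun x => ?_)
        simp only [partialDeriv_mul (h1 n).smooth (k1 n).smooth]
        ring
      · simp only [mul_assoc]
        exact (hU j).integrable_mul (memLp_of_continuous (d1.mul c2) 2)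
      · simp only [mul_assoc]
        exact (hU j).integrable_mul (memLp_of_continuous (c1.mul d2) 2)
    rw [Finset.sum_congr rfl fun j _ => hI j, Finset.sum_neg_distrib, ← integral_finsetSum]
    · rw [neg_eq_zero]
      refine integral_eq_zero_of_ae ?_
      filter_upwards [hdiv] with x hx
      rw [← Finset.sum_mul, hx, zero_mul, Pi.zero_apply]
    · exact fun j _ => (hDU j j).integrable_mul (memLp_of_continuous (c1.mul c2) 2)
  have ht : Tendsto (fun n => ∑ j, ((∫ x, (U j x * partialDeriv j (φ n) x) * χ n x ∂(chan L₁ L₃)) +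
      ∫ x, (U j x * φ n x) * partialDeriv j (χ n) x ∂(chan L₁ L₃))) atTop
      (𝓝 (∑ j, ((∫ x, (U j x * Da j x) * b x ∂(chan L₁ L₃)) +
      ∫ x, (U j x * a x) * Db j x ∂(chan L₁ L₃)))) :=
    tendsto_finsetSum _ fun j _ =>
      (((h3 j).bdd_mul (hU j).1 (hM j)).integral_mul k2).add
        ((h2.bdd_mul (hU j).1 (hM j)).integral_mul (k3 j))
  refine tendsto_nhds_unique ht ?_
  simp only [hn]
  exact tendsto_const_nhds

lemma IsTest.memH10 (h₁ : 0 < L₁) (h₃ : 0 < L₃) {φ : Space → ℝ} (hφ : IsTest L₁ L₃ φ) :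
    MemH10 L₁ L₃ φ (fun j => partialDeriv j φ) :=
  ⟨⟨memLp_of_continuous hφ.smooth.continuous 2,
    fun j => memLp_of_continuous (continuous_partialDeriv hφ.smooth j) 2,
    hφ.isPeriodicSmooth.hasWeakGrad h₁ h₃⟩, fun ε _ => ⟨φ, hφ, by simp, by simp⟩⟩

end Couette

/-! ### Wall-normal slices and the weighted Poincaré inequality -/

namespace Couette

variable {L₁ L₃ : ℝ}

/-- The point at height `y` above the point `z` of the wall. -/
def slicePoint (y : ℝ) (z : Fin 2 → ℝ) : Space := Fin.insertNth (α := fun _ => ℝ) 1 y z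

@[simp] lemma slicePoint_one (y : ℝ) (z : Fin 2 → ℝ) : slicePoint y z 1 = y := by
  simp [slicePoint]

lemma continuous_slicePoint : Continuous fun p : ℝ × (Fin 2 → ℝ) => slicePoint p.1 p.2 := by
  unfold slicePoint; fun_prop

/-- The wall `[0, L₁] × [0, L₃]`. -/
def wall (L₁ L₃ : ℝ) : Set (Fin 2 → ℝ) := Icc ![0, 0] ![L₁, L₃]

lemma slicePoint_mem_cell_iff (y : ℝ) (z : Fin 2 → ℝ) :
    slicePoint y z ∈ cell L₁ L₃ ↔ y ∈ Icc (-1 / 2 : ℝ) (1 / 2) ∧ z ∈ wall L₁ L₃ := by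
  have h0 : slicePoint y z 0 = z 0 := rfl
  have h2 : slicePoint y z 2 = z 1 := rfl
  simp only [cell, wall, mem_Icc, Pi.le_def, Fin.forall_fin_succ]
  simp [h0, h2]
  tauto

lemma integral_chan_eq_slices {F : Space → ℝ} (hF : Continuous F) :
    ∫ x, F x ∂(chan L₁ L₃) =
      ∫ z in wall L₁ L₃, ∫ y in Icc (-1 / 2 : ℝ) (1 / 2), F (slicePoint y z) := by
  have hmp := (volume_preserving_piFinSuccAbove (fun _ : Fin 3 => ℝ) 1).symm
  have he := MeasurableEquiv.measurableEmbedding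
    (MeasurableEquiv.piFinSuccAbove (fun _ : Fin 3 => ℝ) 1).symm
  have hpre : (MeasurableEquiv.piFinSuccAbove (fun _ : Fin 3 => ℝ) 1).symm ⁻¹' (cell L₁ L₃) =
      Icc (-1 / 2 : ℝ) (1 / 2) ×ˢ wall L₁ L₃ := by
    ext ⟨y, z⟩
    exact slicePoint_mem_cell_iff y z
  have h := hmp.setIntegral_preimage_emb he F (cell L₁ L₃)
  rw [chan, ← h, hpre, Measure.volume_eq_prod, ← Measure.prod_restrict, integral_prod_symm]
  · rfl
  · rw [Measure.prod_restrict]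
    exact (hF.comp continuous_slicePoint).continuousOn.integrableOn_compact
      (isCompact_Icc.prod isCompact_Icc)

lemma volume_real_wall (h₁ : 0 < L₁) (h₃ : 0 < L₃) : volume.real (wall L₁ L₃) = L₁ * L₃ := by
  rw [wall, Measure.real, Real.volume_Icc_pi_toReal] <;>
    simp [Pi.le_def, Fin.forall_fin_two, h₁.le, h₃.le]

lemma integral_chan_wallNormal (h₁ : 0 < L₁) (h₃ : 0 < L₃) {Z : ℝ → ℝ} (hZ : Continuous Z) :
    ∫ x, Z (x 1) ∂(chan L₁ L₃) = L₁ * L₃ * ∫ y in (-1 / 2 : ℝ)..(1 / 2), Z y := by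
  rw [integral_chan_eq_slices (F := fun x => Z (x 1)) (hZ.comp (continuous_apply 1))]
  simp only [slicePoint_one, integral_const, smul_eq_mul, measureReal_restrict_apply_univ,
    volume_real_wall h₁ h₃]
  rw [integral_Icc_eq_integral_Ioc, intervalIntegral.integral_of_le (by norm_num)]

/-- Cauchy–Schwarz, obtained by expanding ∫(h - m)² ≥ 0 with m the mean of h. -/
lemma sq_intervalIntegral_le {h : ℝ → ℝ} (hh : Continuous h) {a b : ℝ} (hab : a ≤ b) :
    (∫ y in a..b, h y) ^ 2 ≤ (b - a) * ∫ y in a..b, h y ^ 2 := by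
  rcases hab.eq_or_lt with rfl | hab'
  · simp
  set m := (∫ y in a..b, h y) / (b - a) with hm
  have hpos : 0 < b - a := sub_pos.2 hab'
  have h0 : 0 ≤ ∫ y in a..b, (h y - m) ^ 2 :=
    intervalIntegral.integral_nonneg hab fun _ _ => sq_nonneg _
  have e : ∫ y in a..b, (h y - m) ^ 2 =
      (∫ y in a..b, h y ^ 2) - 2 * m * (∫ y in a..b, h y) + (b - a) * m ^ 2 := by
    have : ∀ y, (h y - m) ^ 2 = (h y ^ 2 - 2 * m * h y) + m ^ 2 := fun y => by ring
    simp only [this]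
    rw [intervalIntegral.integral_add, intervalIntegral.integral_sub,
      intervalIntegral.integral_const_mul, intervalIntegral.integral_const, smul_eq_mul] <;>
    exact Continuous.intervalIntegrable (by fun_prop) _ _
  have hmI : (∫ y in a..b, h y) = m * (b - a) := by rw [hm]; field_simp
  rw [e, hmI] at h0
  rw [hmI]
  nlinarith

/-- The pointwise trace inequality behind the weighted Poincaré inequality. -/
lemma sq_le_dist_wall_mul {g : ℝ → ℝ} (hg : ContDiff ℝ 1 g) (h0 : g (-1 / 2) = 0)
    (h1 : g (1 / 2) = 0) {y : ℝ} (hy : y ∈ Icc (-1 / 2 : ℝ) (1 / 2)) :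
    g y ^ 2 ≤ (1 / 2 - |y|) * ∫ s in (-1 / 2 : ℝ)..(1 / 2), deriv g s ^ 2 := by
  have hc : Continuous (deriv g) := hg.continuous_deriv le_rfl
  have hd : ∀ x, HasDerivAt g (deriv g x) x :=
    fun x => (hg.differentiable one_ne_zero x).hasDerivAt
  have ftc : ∀ a b, ∫ s in a..b, deriv g s = g b - g a := fun a b =>
    intervalIntegral.integral_eq_sub_of_hasDerivAt (fun x _ => hd x) (hc.intervalIntegrable _ _)
  have hi : ∀ a b, IntervalIntegrable (fun s => deriv g s ^ 2) volume a b :=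
    fun a b => (hc.pow 2).intervalIntegrable a b
  have hadd := intervalIntegral.integral_add_adjacent_intervals (hi (-1 / 2) y) (hi y (1 / 2))
  have n1 : 0 ≤ ∫ s in (-1 / 2 : ℝ)..y, deriv g s ^ 2 :=
    intervalIntegral.integral_nonneg hy.1 fun _ _ => sq_nonneg _
  have n2 : 0 ≤ ∫ s in y..(1 / 2 : ℝ), deriv g s ^ 2 :=
    intervalIntegral.integral_nonneg hy.2 fun _ _ => sq_nonneg _
  -- Integrate g' from the nearer wall, which is at distance 1/2 - |y|; the energy on the other side
  -- of y is only added.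
  rcases le_total y 0 with h | h
  · have := sq_intervalIntegral_le hc hy.1
    rw [ftc, h0, sub_zero] at this
    rw [abs_of_nonpos h, ← hadd]
    nlinarith [hy.1]
  · have := sq_intervalIntegral_le hc hy.2
    rw [ftc, h1, zero_sub, neg_sq] at this
    rw [abs_of_nonneg h, ← hadd]
    nlinarith [hy.2]

/-- On each wall-normal line the trace inequality bounds φ² by the wall distance times a factor
independent of the height, so the weight integrates separately; then integrate over the wall. -/
lemma IsTest.integral_weight_mul_sq_le {φ : Space → ℝ} (hφ : IsTest L₁ L₃ φ) {ρ : ℝ → ℝ}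
    (hρ : Continuous ρ) (h0 : ∀ y, 0 ≤ ρ y) :
    ∫ x, ρ (x 1) * φ x ^ 2 ∂(chan L₁ L₃) ≤
      (∫ y in (-1 / 2 : ℝ)..(1 / 2), ρ y * (1 / 2 - |y|)) *
        ∫ x, partialDeriv 1 φ x ^ 2 ∂(chan L₁ L₃) := by
  have hc := hφ.smooth.continuous
  have hc' := continuous_partialDeriv hφ.smooth 1
  have hρ1 : Continuous fun x : Space => ρ (x 1) := hρ.comp (continuous_apply 1)
  have hsl : ∀ z, Continuous fun y => slicePoint y z := fun z =>
    continuous_slicePoint.comp (by fun_prop : Continuous fun y : ℝ => (y, z))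
  rw [integral_chan_eq_slices (F := fun x => ρ (x 1) * φ x ^ 2) (hρ1.mul (hc.pow 2)),
    integral_chan_eq_slices (F := fun x => partialDeriv 1 φ x ^ 2) (hc'.pow 2),
    ← integral_const_mul]
  have hcont2 : ∀ F : Space → ℝ, Continuous F →
      IntegrableOn (fun z => ∫ y in Icc (-1 / 2 : ℝ) (1 / 2), F (slicePoint y z)) (wall L₁ L₃) := by
    intro F hF
    have : Continuous fun z => ∫ y in Icc (-1 / 2 : ℝ) (1 / 2), F (slicePoint y z) :=
      continuous_parametric_integral_of_continuous
        (f := fun z y => F (slicePoint y z))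
        (hF.comp (continuous_slicePoint.comp continuous_swap)) isCompact_Icc
    exact this.continuousOn.integrableOn_compact isCompact_Icc
  refine integral_mono (hcont2 _ (hρ1.mul (hc.pow 2))) ((hcont2 _ (hc'.pow 2)).const_mul _) ?_
  intro z
  simp only [slicePoint_one]
  set g : ℝ → ℝ := fun y => φ (slicePoint y z) with hgdef
  have hline : ∀ y, slicePoint y z = slicePoint 0 z + y • Pi.single 1 1 := by
    intro y; ext i
    fin_cases i
    · show z 0 = z 0 + y * 0
      simp
    · simp
    · show z 1 = z 1 + y * 0
      simp
  have hlined : ∀ y, HasDerivAt (fun y => slicePoint y z) (Pi.single 1 1 : Space) y := by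
    intro y
    have h1 : HasDerivAt (fun y : ℝ => slicePoint 0 z + y • (Pi.single 1 1 : Space))
        ((1 : ℝ) • (Pi.single 1 1 : Space)) y :=
      ((hasDerivAt_id y).smul_const _).const_add _
    rw [one_smul] at h1
    exact h1.congr_of_eventuallyEq (Eventually.of_forall hline)
  have hg' : ∀ y, HasDerivAt g (partialDeriv 1 φ (slicePoint y z)) y := fun y =>
    ((hφ.smooth.differentiable (by simp) (slicePoint y z)).hasFDerivAt).comp_hasDerivAt y (hlined y)
  have hgd : deriv g = fun y => partialDeriv 1 φ (slicePoint y z) := funext fun y => (hg' y).deriv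
  have hgc : ContDiff ℝ 1 g := contDiff_one_iff_deriv.2
    ⟨fun y => (hg' y).differentiableAt, by rw [hgd]; exact hc'.comp (hsl z)⟩
  obtain ⟨r, hr, hs⟩ := hφ.support
  have hz : ∀ c : ℝ, r < |c| → g c = 0 := by
    intro c hc
    by_contra hne
    have := hs _ hne
    simp only [slicePoint_one] at this
    linarith
  have e1 := hz (1 / 2) (by rw [abs_of_pos] <;> linarith)
  have e2 := hz (-1 / 2) (by rw [abs_of_neg] <;> linarith)
  rw [integral_Icc_eq_integral_Ioc, integral_Icc_eq_integral_Ioc,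
    ← intervalIntegral.integral_of_le (by norm_num), ← intervalIntegral.integral_of_le (by norm_num),
    ← intervalIntegral.integral_mul_const]
  refine intervalIntegral.integral_mono_on (by norm_num)
    ((hρ.mul (hgc.continuous.pow 2)).intervalIntegrable _ _)
    (Continuous.intervalIntegrable (by fun_prop) _ _) fun y hy => ?_
  have := sq_le_dist_wall_mul hgc e2 e1 hy
  rw [hgd] at this
  calc ρ y * g y ^ 2 ≤ ρ y * ((1 / 2 - |y|) *
        ∫ s in (-1 / 2 : ℝ)..(1 / 2), partialDeriv 1 φ (slicePoint s z) ^ 2) :=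
      mul_le_mul_of_nonneg_left this (h0 y)
    _ = _ := by ring

/-- A weighted Poincaré inequality in the wall-normal direction. -/
lemma MemH10.integral_weight_mul_sq_le {a : Space → ℝ} {Da : Fin 3 → Space → ℝ}
    (ha : MemH10 L₁ L₃ a Da) {ρ : ℝ → ℝ} (hρ : Continuous ρ) (h0 : ∀ y, 0 ≤ ρ y) :
    ∫ x, ρ (x 1) * a x ^ 2 ∂(chan L₁ L₃) ≤
      (∫ y in (-1 / 2 : ℝ)..(1 / 2), ρ y * (1 / 2 - |y|)) *
        ∫ x, Da 1 x ^ 2 ∂(chan L₁ L₃) := by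
  obtain ⟨φ, h1, h2, h3⟩ := ha.exists_seq
  have hρ1 : Continuous fun x : Space => ρ (x 1) := hρ.comp (continuous_apply 1)
  obtain ⟨C, hC⟩ := isCompact_cell.exists_bound_of_continuousOn (s := cell L₁ L₃) hρ1.continuousOn
  have t1 := (h2.bdd_mul hρ1.aestronglyMeasurable
    (ae_restrict_of_forall_mem measurableSet_cell hC)).integral_mul h2
  have t2 := ((h3 1).integral_mul (h3 1)).const_mul
    (∫ y in (-1 / 2 : ℝ)..(1 / 2), ρ y * (1 / 2 - |y|))
  simp only [pow_two, ← mul_assoc (ρ _)]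
  refine le_of_tendsto_of_tendsto' t1 t2 fun n => ?_
  have := (h1 n).integral_weight_mul_sq_le hρ h0
  simpa only [pow_two, ← mul_assoc (ρ _)] using this

end Couette

/-! ### Periodic extension and the fundamental lemma of the calculus of variations -/

namespace Couette

variable {L₁ L₃ : ℝ}

/-- The `L`-periodic extension in the `i`-th coordinate of the restriction to `0 ≤ xᵢ < L`. -/
noncomputable def periodize (i : Fin 3) {L : ℝ} (hL : 0 < L) (φ : Space → ℝ) (x : Space) : ℝ :=
  φ (Function.update x i (toIcoMod hL 0 (x i)))

lemma periodize_add_single (i : Fin 3) {L : ℝ} (hL : 0 < L) (φ : Space → ℝ) (x : Space) :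
    periodize i hL φ (x + Pi.single i L) = periodize i hL φ x := by
  unfold periodize
  congr 1
  ext k
  by_cases h : k = i
  · subst h; simp
  · simp [h]

lemma periodize_add_single_of_ne {i k : Fin 3} (hik : k ≠ i) {L M : ℝ} (hL : 0 < L) {φ : Space → ℝ}
    (hφ : ∀ x, φ (x + Pi.single k M) = φ x) (x : Space) :
    periodize i hL φ (x + Pi.single k M) = periodize i hL φ x := by
  unfold periodize
  rw [← hφ (Function.update x i _)]
  congr 1
  ext l
  by_cases h : l = i
  · subst h; simp [hik.symm]
  · simp [h]

lemma periodize_eq (i : Fin 3) {L : ℝ} (hL : 0 < L) (φ : Space → ℝ) {x : Space}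
    (hx : x i ∈ Ico 0 L) : periodize i hL φ x = φ x := by
  unfold periodize
  rw [(toIcoMod_eq_self hL).2 (by simpa using hx), Function.update_eq_self]

lemma contDiff_periodize (i : Fin 3) {L ε : ℝ} (hL : 0 < L) (hε : 0 < ε) {φ : Space → ℝ}
    (hφ : ContDiff ℝ ∞ φ) (hs : ∀ x, φ x ≠ 0 → x i ∈ Icc ε (L - ε)) :
    ContDiff ℝ ∞ (periodize i hL φ) := by
  rw [contDiff_iff_contDiffAt]
  intro x
  have hmod : ∀ (n : ℤ) (y : Space), y i - n • L ∈ Ico 0 L →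
      periodize i hL φ y = φ (Function.update y i (y i - n • L)) := by
    intro n y hy
    unfold periodize
    have := (toIcoMod_eq_self hL (a := 0)).2 (by rw [zero_add]; exact hy)
    rw [← this, toIcoMod_sub_zsmul]
  set n := toIcoDiv hL 0 (x i) with hn
  have hxm : x i - n • L ∈ Ico 0 L := by
    have := sub_toIcoDiv_zsmul_mem_Ico hL 0 (x i)
    rwa [zero_add] at this
  -- If x i is a multiple of L, the extension vanishes near x: the margin ε kills it on both sides,
  -- and staying within L limits the possible period indices to n and n - 1. Otherwise it is locally
  -- a translate of φ.
  rcases hxm.1.eq_or_lt with h0 | h0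
  · have hev : ∀ᶠ y : Space in 𝓝 x, y i ∈ Ioo (x i - min ε L) (x i + min ε L) :=
      (continuous_apply i).continuousAt.eventually (Ioo_mem_nhds (by simp [hε, hL]) (by simp [hε, hL]))
    refine (contDiffAt_const (c := (0 : ℝ))).congr_of_eventuallyEq ?_
    filter_upwards [hev] with y hy
    have m1 := min_le_left ε L
    have m2 := min_le_right ε L
    by_contra hne
    rcases le_or_gt (x i) (y i) with hxy | hxy
    · rw [hmod n y ⟨by linarith, by linarith [hy.2]⟩] at hne
      have := (hs _ hne).1
      simp only [Function.update_self] at this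
      linarith [hy.2]
    · have e : y i - (n - 1) • L = y i - n • L + L := by simp [sub_smul]; ring
      rw [hmod (n - 1) y ⟨by linarith [hy.1], by linarith⟩] at hne
      have := (hs _ hne).2
      simp only [Function.update_self] at this
      linarith [hy.1]
  · have hev : ∀ᶠ y : Space in 𝓝 x, y i ∈ Ioo (n • L) (n • L + L) :=
      (continuous_apply i).continuousAt.eventually
        (Ioo_mem_nhds (by linarith) (by linarith [hxm.2]))
    have hcd : ContDiffAt ℝ ∞ (fun y : Space => φ (y - Pi.single i (n • L))) x :=
      (hφ.comp (contDiff_id.sub contDiff_const)).contDiffAt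
    refine hcd.congr_of_eventuallyEq ?_
    filter_upwards [hev] with y hy
    rw [hmod n y ⟨by linarith [hy.1], by linarith [hy.2]⟩]
    congr 1
    ext k
    by_cases h : k = i
    · subst h; simp
    · simp [h]

/-- Every `C_c^∞` function on the open cell agrees on it with a test function on the channel. -/
lemma exists_isTest_eq (h₁ : 0 < L₁) (h₃ : 0 < L₃) {φ : Space → ℝ} (hφ : ContDiff ℝ ∞ φ)
    (hc : HasCompactSupport φ)
    (hs : tsupport φ ⊆ Set.pi univ fun i => Ioo ((![0, -1 / 2, 0] : Space) i)
      ((![L₁, 1 / 2, L₃] : Space) i)) :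
    ∃ χ, IsTest L₁ L₃ χ ∧ ∀ x ∈ Set.pi univ fun i => Ioo ((![0, -1 / 2, 0] : Space) i)
      ((![L₁, 1 / 2, L₃] : Space) i), χ x = φ x := by
  have hK : IsCompact (tsupport φ) := hc
  -- Compactness of the support gives a positive margin to each face. In the tangential directions
  -- it makes the extension smooth; in the wall-normal direction it supplies the radius r < 1/2.
  have hbd : ∀ (i : Fin 3) (a b : ℝ), (∀ x ∈ tsupport φ, x i ∈ Ioo a b) →
      ∃ ε > 0, ∀ x, φ x ≠ 0 → x i ∈ Icc (a + ε) (b - ε) := by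
    intro i a b h
    rcases (tsupport φ).eq_empty_or_nonempty with he | hne
    · refine ⟨1, one_pos, fun x hx => ?_⟩
      have := subset_tsupport φ hx
      simp [he] at this
    · obtain ⟨x0, hx0, hmin⟩ := hK.exists_isMinOn hne (continuous_apply i).continuousOn
      obtain ⟨x1, hx1, hmax⟩ := hK.exists_isMaxOn hne (continuous_apply i).continuousOn
      have p0 := (h x0 hx0).1
      have p1 := (h x1 hx1).2
      refine ⟨min (x0 i - a) (b - x1 i), lt_min (by linarith) (by linarith), fun x hx => ?_⟩
      have m := subset_tsupport φ hx
      have q0 : x0 i ≤ x i := hmin m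
      have q1 : x i ≤ x1 i := hmax m
      have m1 := min_le_left (x0 i - a) (b - x1 i)
      have m2 := min_le_right (x0 i - a) (b - x1 i)
      exact ⟨by linarith, by linarith⟩
  obtain ⟨ε₀, hε₀, s0⟩ := hbd 0 0 L₁ fun x hx => by simpa using hs hx 0 (mem_univ _)
  obtain ⟨ε₁, hε₁, s1⟩ := hbd 1 (-1 / 2) (1 / 2) fun x hx => by simpa using hs hx 1 (mem_univ _)
  obtain ⟨ε₂, hε₂, s2⟩ := hbd 2 0 L₃ fun x hx => by simpa using hs hx 2 (mem_univ _)
  simp only [zero_add] at s0 s2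
  have sm := contDiff_periodize 0 h₁ hε₀ hφ s0
  have s2' : ∀ x, periodize 0 h₁ φ x ≠ 0 → x 2 ∈ Icc ε₂ (L₃ - ε₂) := fun x hx => by
    simpa using s2 _ hx
  refine ⟨periodize 2 h₃ (periodize 0 h₁ φ), ⟨contDiff_periodize 2 h₃ hε₂ sm s2',
    periodize_add_single_of_ne (by decide) h₃ (periodize_add_single 0 h₁ φ),
    periodize_add_single 2 h₃ _, 1 / 2 - ε₁, by linarith, fun x hx => ?_⟩, fun x hx => ?_⟩
  · have := s1 _ hx
    simp at this
    rw [abs_le]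
    constructor <;> linarith [this.1, this.2]
  · have a0 := hx 0 (mem_univ _)
    have a2 := hx 2 (mem_univ _)
    simp at a0 a2
    rw [periodize_eq 2 h₃ _ ⟨a2.1.le, a2.2⟩, periodize_eq 0 h₁ _ ⟨a0.1.le, a0.2⟩]

/-- The fundamental lemma of the calculus of variations on the channel. -/
lemma ae_eq_zero_of_forall_isTest (h₁ : 0 < L₁) (h₃ : 0 < L₃) {J : Space → ℝ}
    (hJ : Integrable J (chan L₁ L₃))
    (h : ∀ φ, IsTest L₁ L₃ φ → ∫ x, J x * φ x ∂(chan L₁ L₃) = 0) :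
    ∀ᵐ x ∂(chan L₁ L₃), J x = 0 := by
  set B : Set Space := Set.pi univ fun i => Ioo ((![0, -1 / 2, 0] : Space) i)
      ((![L₁, 1 / 2, L₃] : Space) i) with hB
  have hBo : IsOpen B := isOpen_set_pi finite_univ fun _ _ => isOpen_Ioo
  -- The faces of the cell are null, so the fundamental lemma on the open box suffices.
  have hBae : (B : Set Space) =ᵐ[volume] cell L₁ L₃ := Measure.univ_pi_Ioo_ae_eq_Icc
  have hBr : chan L₁ L₃ = volume.restrict B := (Measure.restrict_congr_set hBae).symm
  rw [hBr] at hJ ⊢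
  have hz := hBo.ae_eq_zero_of_integral_contDiff_smul_eq_zero (μ := volume)
    (f := J) (IntegrableOn.locallyIntegrableOn hJ) ?_
  · exact (ae_restrict_iff' hBo.measurableSet).2 hz
  · intro φ hφ hc hs
    obtain ⟨χ, hχ, he⟩ := exists_isTest_eq h₁ h₃ hφ hc hs
    rw [← h χ hχ, hBr, ← setIntegral_eq_integral_of_forall_compl_eq_zero (s := B)]
    · refine setIntegral_congr_fun hBo.measurableSet fun x hx => ?_
      simp only [smul_eq_mul, he x hx, mul_comm]
    · intro x hx
      have : φ x = 0 := image_eq_zero_of_notMem_tsupport fun hm => hx (hs hm)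
      simp [this]

end Couette

/-! ### Weak derivatives in time and the one-variable energy inequality -/

namespace Couette

lemma intervalIntegrable_of_locallyIntegrable {g : ℝ → ℝ} (hg : LocallyIntegrable g) (a b : ℝ) :
    IntervalIntegrable g volume a b :=
  intervalIntegrable_iff.2
    ((hg.integrableOn_isCompact isCompact_uIcc).mono_set uIoc_subset_uIcc)

lemma hasDerivAt_primitive {h : ℝ → ℝ} (hh : Continuous h) (c t : ℝ) :
    HasDerivAt (fun t => ∫ s in c..t, h s) (h t) t :=
  intervalIntegral.integral_hasDerivAt_right (hh.intervalIntegrable _ _)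
    hh.stronglyMeasurable.stronglyMeasurableAtFilter hh.continuousAt

lemma deriv_primitive {h : ℝ → ℝ} (hh : Continuous h) (c : ℝ) :
    deriv (fun t => ∫ s in c..t, h s) = h :=
  funext fun t => (hasDerivAt_primitive hh c t).deriv

lemma contDiff_primitive {h : ℝ → ℝ} (hh : ContDiff ℝ ∞ h) (c : ℝ) :
    ContDiff ℝ ∞ (fun t => ∫ s in c..t, h s) := by
  rw [contDiff_infty_iff_deriv, deriv_primitive hh.continuous]
  exact ⟨fun t => (hasDerivAt_primitive hh.continuous c t).differentiableAt, hh⟩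

lemma primitive_eq_zero {h : ℝ → ℝ} (hh : Continuous h) {a b c t : ℝ} (hca : c ≤ a)
    (hs : ∀ s, s ∉ Icc a b → h s = 0) (h0 : ∫ s, h s = 0) (ht : t ∉ Icc a b) :
    ∫ s in c..t, h s = 0 := by
  have hi : ∀ a b, IntervalIntegrable h volume a b := fun a b => hh.intervalIntegrable a b
  have hne : ∀ᵐ s : ℝ, s ≠ a := by simp [ae_iff]
  by_cases hta : t < a
  · refine (intervalIntegral.integral_congr_ae (g := fun _ => 0) ?_).trans (by simp)
    filter_upwards [hne] with s hsa hs'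
    rw [uIoc, mem_Ioc] at hs'
    exact hs s fun hm => hsa (le_antisymm (hs'.2.trans (max_le hca hta.le)) hm.1)
  · have htb : b < t := by
      by_contra hb
      exact ht ⟨not_lt.1 hta, not_lt.1 hb⟩
    have hsub : Function.support h ⊆ Icc a t := fun s hs' => by
      by_contra hm
      exact hs' (hs s fun hm' => hm ⟨hm'.1, hm'.2.trans htb.le⟩)
    have hat : a ≤ t := not_lt.1 hta
    have hI : ∫ s in Icc a t, h s = 0 := by
      rw [setIntegral_eq_integral_of_forall_compl_eq_zero, h0]
      exact fun s hs' => by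
        by_contra hne
        exact hs' (hsub hne)
    rw [integral_Icc_eq_integral_Ioc, ← intervalIntegral.integral_of_le hat] at hI
    rw [← intervalIntegral.integral_add_adjacent_intervals (hi c a) (hi a t), hI, add_zero]
    refine (intervalIntegral.integral_congr_ae (g := fun _ => 0) ?_).trans (by simp)
    filter_upwards [hne] with s hsa hs'
    rw [uIoc_of_le hca] at hs'
    exact hs s fun hm => hsa (le_antisymm hs'.2 hm.1)

/-- Integration by parts for absolutely continuous functions: the primitive vanishes at 0 and θ at
b, so there are no boundary terms. -/
lemma integral_primitive_mul_deriv {g : ℝ → ℝ} (hg : LocallyIntegrable g) {θ : ℝ → ℝ}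
    (hθ : ContDiff ℝ 1 θ) {b : ℝ} (h1 : θ b = 0) :
    ∫ t in (0 : ℝ)..b, (∫ s in (0 : ℝ)..t, g s) * deriv θ t = -∫ t in (0 : ℝ)..b, g t * θ t := by
  have hgi : IntervalIntegrable g volume 0 b :=
    intervalIntegrable_of_locallyIntegrable hg 0 b
  have acG := hgi.absolutelyContinuousOnInterval_intervalIntegral (c := 0) (by simp)
  have acθ := (hθ.contDiffOn (s := uIcc 0 b)).absolutelyContinuousOnInterval
  rw [acG.integral_mul_deriv_eq_deriv_mul acθ]
  simp only [h1, mul_zero, intervalIntegral.integral_same, zero_mul, sub_zero, zero_sub]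
  congr 1
  refine intervalIntegral.integral_congr_ae ?_
  filter_upwards [LocallyIntegrable.ae_hasDerivAt_integral hg] with t ht _
  rw [(ht 0).deriv]

/-- A sequence of bumps shrinking to the origin. -/
noncomputable def timeBump (n : ℕ) : ContDiffBump (0 : ℝ) :=
  -- The outer radius is twice the inner one for every n; such a fixed ratio is what the almost
  -- everywhere convergence of mollifications requires.
  ⟨1 / (2 * (n + 1)), 1 / (n + 1), by positivity, by
    rw [div_lt_div_iff₀ (by positivity) (by positivity)]
    have : (0 : ℝ) ≤ n := n.cast_nonneg
    linarith⟩

/-- The difference of two translates of a bump. -/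
noncomputable def bumpDiff (n : ℕ) (p q s : ℝ) : ℝ :=
  (timeBump n).normed volume (p - s) - (timeBump n).normed volume (q - s)

lemma contDiff_bumpDiff (n : ℕ) (p q : ℝ) : ContDiff ℝ ∞ (bumpDiff n p q) :=
  (((timeBump n).contDiff_normed (n := ⊤)).comp (contDiff_const.sub contDiff_id)).sub
    (((timeBump n).contDiff_normed (n := ⊤)).comp (contDiff_const.sub contDiff_id))

/-- The primitive of `bumpDiff`, a smoothed indicator function. -/
noncomputable def timeCutoff (n : ℕ) (p q t : ℝ) : ℝ := ∫ s in (0 : ℝ)..t, bumpDiff n p q s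

lemma contDiff_timeCutoff (n : ℕ) (p q : ℝ) : ContDiff ℝ ∞ (timeCutoff n p q) :=
  contDiff_primitive (contDiff_bumpDiff n p q) 0

lemma deriv_timeCutoff (n : ℕ) (p q : ℝ) : deriv (timeCutoff n p q) = bumpDiff n p q :=
  deriv_primitive (contDiff_bumpDiff n p q).continuous 0

lemma timeBump_normed_eq_zero {n : ℕ} {x : ℝ} (hx : 1 / ((n : ℝ) + 1) ≤ |x|) :
    (timeBump n).normed volume x = 0 := by
  rw [← Function.notMem_support, (timeBump n).support_normed_eq]
  simpa [timeBump] using hx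

lemma bumpDiff_eq_zero {n : ℕ} {p q s : ℝ}
    (hs : s ∉ Icc (min p q - 1 / ((n : ℝ) + 1)) (max p q + 1 / ((n : ℝ) + 1))) :
    bumpDiff n p q s = 0 := by
  have key : ∀ r, min p q ≤ r → r ≤ max p q → 1 / ((n : ℝ) + 1) ≤ |r - s| := by
    intro r h1 h2
    by_contra hlt
    rw [not_le, abs_lt] at hlt
    exact hs ⟨by linarith [hlt.2], by linarith [hlt.1]⟩
  rw [bumpDiff, timeBump_normed_eq_zero (key p (min_le_left _ _) (le_max_left _ _)),
    timeBump_normed_eq_zero (key q (min_le_right _ _) (le_max_right _ _)), sub_zero]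

lemma integral_bumpDiff (n : ℕ) (p q : ℝ) : ∫ s, bumpDiff n p q s = 0 := by
  unfold bumpDiff
  rw [integral_sub, integral_sub_left_eq_self (fun s => (timeBump n).normed volume s),
    integral_sub_left_eq_self (fun s => (timeBump n).normed volume s), sub_self]
  · exact (timeBump n).integrable_normed.comp_sub_left p
  · exact (timeBump n).integrable_normed.comp_sub_left q

/-- Since `bumpDiff` has integral zero, its primitive also vanishes beyond the support. The lower
bounds on p and q keep that support inside (0, ∞), so the cutoff is an admissible test function of
time. -/
lemma timeCutoff_eq_zero {n : ℕ} {p q t : ℝ} (hp : 1 / ((n : ℝ) + 1) < p)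
    (hq : 1 / ((n : ℝ) + 1) < q)
    (ht : t ∉ Icc (min p q - 1 / ((n : ℝ) + 1)) (max p q + 1 / ((n : ℝ) + 1))) :
    timeCutoff n p q t = 0 :=
  primitive_eq_zero (contDiff_bumpDiff n p q).continuous
    (by rw [sub_nonneg]; exact (lt_min hp hq).le) (fun _ => bumpDiff_eq_zero)
    (integral_bumpDiff n p q) ht

/-- A function with an integrable weak derivative is a primitive of it; only countably many test
functions are needed. -/
lemma exists_ae_eq_const_add_primitive {f g : ℝ → ℝ} (hf : LocallyIntegrable f)
    (hg : LocallyIntegrable g)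
    (h : ∀ (n : ℕ) (p q : ℚ), 1 / ((n : ℝ) + 1) < p → 1 / ((n : ℝ) + 1) < q →
      ∫ t, f t * bumpDiff n p q t = -∫ t, g t * timeCutoff n p q t) :
    ∃ c, ∀ᵐ t : ℝ, 0 < t → f t = c + ∫ s in (0 : ℝ)..t, g s := by
  set G : ℝ → ℝ := fun t => ∫ s in (0 : ℝ)..t, g s with hG
  have hGc : Continuous G :=
    intervalIntegral.continuous_primitive (intervalIntegrable_of_locallyIntegrable hg) 0
  have hD : LocallyIntegrable (fun t => f t - G t) := hf.sub hGc.locallyIntegrable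
  -- The mollification of f - G. Testing with the primitive of a difference of two bumps says
  -- exactly that e n takes equal values at the two centres.
  set e : ℕ → ℝ → ℝ := fun n t => ∫ s, (timeBump n).normed volume (t - s) * (f s - G s) with he
  have hec : ∀ n, Continuous (e n) := by
    intro n
    have := (timeBump n).hasCompactSupport_normed (μ := volume).continuous_convolution_left
      (ContinuousLinearMap.lsmul ℝ ℝ) (timeBump n).continuous_normed hD
    refine this.congr fun t => ?_
    rw [convolution_eq_swap]
    simp [he]
  have hint : ∀ (n : ℕ) (p : ℝ) (F : ℝ → ℝ), LocallyIntegrable F →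
      Integrable fun s => (timeBump n).normed volume (p - s) * F s := by
    intro n p F hF
    refine hF.integrable_smul_left_of_hasCompactSupport (g := fun s =>
      (timeBump n).normed volume (p - s)) ((timeBump n).continuous_normed.comp (by fun_prop)) ?_
    exact (timeBump n).hasCompactSupport_normed.comp_homeomorph (Homeomorph.subLeft p)
  have hrat : ∀ (n : ℕ) (p q : ℝ), 1 / ((n : ℝ) + 1) < p → 1 / ((n : ℝ) + 1) < q →
      ∫ t, f t * bumpDiff n p q t = -∫ t, g t * timeCutoff n p q t → e n p = e n q := by
    intro n p q hp hq hpq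
    have hb0 : (0 : ℝ) ≤ max p q + 1 / ((n : ℝ) + 1) + 1 := by
      have hn0 : (0 : ℝ) < 1 / ((n : ℝ) + 1) := by positivity
      have := le_max_left p q
      linarith
    set b : ℝ := max p q + 1 / ((n : ℝ) + 1) + 1 with hb
    have hpos : (0 : ℝ) ≤ min p q - 1 / ((n : ℝ) + 1) := by
      rw [sub_nonneg]; exact (lt_min hp hq).le
    have hzb : ∀ F θ : ℝ → ℝ, (∀ t, t ∉ Icc (min p q - 1 / ((n : ℝ) + 1))
        (max p q + 1 / ((n : ℝ) + 1)) → θ t = 0) →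
        ∫ t, F t * θ t = ∫ t in (0 : ℝ)..b, F t * θ t := by
      intro F θ hθ
      rw [intervalIntegral.integral_of_le hb0, ← integral_Icc_eq_integral_Ioc,
        setIntegral_eq_integral_of_forall_compl_eq_zero]
      intro t ht
      rw [hθ t fun hm => ht ⟨hpos.trans hm.1, by linarith [hm.2]⟩, mul_zero]
    have parts := integral_primitive_mul_deriv hg
      ((contDiff_timeCutoff n p q).of_le (by norm_cast))
      (timeCutoff_eq_zero (t := b) hp hq fun hm => by linarith [hm.2])
    rw [deriv_timeCutoff, ← hzb g _ fun t ht => timeCutoff_eq_zero hp hq ht,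
      ← hzb _ (bumpDiff n p q) fun t ht => bumpDiff_eq_zero ht, ← hpq] at parts
    have i1 := hint n p f hf
    have i2 := hint n q f hf
    have i3 := hint n p G hGc.locallyIntegrable
    have i4 := hint n q G hGc.locallyIntegrable
    have e1 : ∀ F : ℝ → ℝ, (Integrable fun s => (timeBump n).normed volume (p - s) * F s) →
        (Integrable fun s => (timeBump n).normed volume (q - s) * F s) →
        ∫ t, F t * bumpDiff n p q t = (∫ s, (timeBump n).normed volume (p - s) * F s) -
          ∫ s, (timeBump n).normed volume (q - s) * F s := by
      intro F j1 j2
      rw [← integral_sub j1 j2]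
      refine integral_congr_ae (Eventually.of_forall fun s => ?_)
      simp only [bumpDiff]; ring
    rw [e1 f i1 i2, e1 _ i3 i4] at parts
    simp only [he, mul_sub]
    rw [integral_sub i1 i3, integral_sub i2 i4]
    linarith
  -- Equality at rational centres extends to real ones by continuity of e n.
  have hconst : ∀ (n : ℕ) (p q : ℝ), 1 / ((n : ℝ) + 1) < p → 1 / ((n : ℝ) + 1) < q → e n p = e n q := by
    intro n
    have step : ∀ c : ℝ, (∀ p : ℚ, 1 / ((n : ℝ) + 1) < p → e n p = c) →
        ∀ p : ℝ, 1 / ((n : ℝ) + 1) < p → e n p = c := by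
      intro c hc p hp
      have hcl : IsClosed {t | e n t = c} := isClosed_eq (hec n) continuous_const
      refine hcl.closure_subset (mem_closure_iff_nhds.2 fun V hV => ?_)
      obtain ⟨x, hx1, r, rfl⟩ := mem_closure_iff_nhds.1 (Rat.denseRange_cast (𝕜 := ℝ) p) _
        (inter_mem hV (Ioi_mem_nhds hp))
      exact ⟨r, hx1.1, hc r hx1.2⟩
    intro p q hp hq
    exact step _ (fun p' hp' => (step _ (fun q' hq' => hrat n q' p' hq' hp' (h n q' p' hq' hp')) q hq).symm) p hp
  have hlim : ∀ᵐ t : ℝ, Tendsto (fun n => e n t) atTop (𝓝 (f t - G t)) := by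
    have hr : Tendsto (fun n => (timeBump n).rOut) atTop (𝓝 0) :=
      tendsto_one_div_add_atTop_nhds_zero_nat
    have := ContDiffBump.ae_convolution_tendsto_right_of_locallyIntegrable (φ := timeBump)
      (l := atTop) (K := 2) (μ := volume) hr (Eventually.of_forall fun n => by
        simp only [timeBump]
        have : (n : ℝ) + 1 ≠ 0 := by positivity
        field_simp; rfl) hD
    filter_upwards [this] with t ht
    refine ht.congr fun n => ?_
    rw [convolution_eq_swap]
    simp [he]
  obtain ⟨t₀, ht₀, hl₀⟩ : ∃ t₀ > (0 : ℝ), Tendsto (fun n => e n t₀) atTop (𝓝 (f t₀ - G t₀)) := by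
    have hne : (ae (volume.restrict (Ioi (0 : ℝ)))).NeBot := by
      rw [ae_neBot, Ne, Measure.restrict_eq_zero]; simp
    obtain ⟨t, h1, h2⟩ :=
      ((ae_restrict_mem (measurableSet_Ioi (a := (0 : ℝ)))).and (ae_restrict_of_ae hlim)).exists
    exact ⟨t, h1, h2⟩
  refine ⟨f t₀ - G t₀, ?_⟩
  filter_upwards [hlim] with t ht hpos
  have hev : ∀ᶠ n : ℕ in atTop, e n t = e n t₀ := by
    filter_upwards [tendsto_one_div_add_atTop_nhds_zero_nat.eventually
      (gt_mem_nhds (lt_min hpos ht₀))] with n hn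
    exact hconst n t t₀ (hn.trans_le (min_le_left _ _)) (hn.trans_le (min_le_right _ _))
  have := tendsto_nhds_unique (ht.congr' hev) hl₀
  linarith

/-- The energy inequality for one absolutely continuous function. -/
lemma neg_le_intervalIntegral_mul {f g : ℝ → ℝ} (hg : LocallyIntegrable g) {c : ℝ}
    (hfg : ∀ᵐ t : ℝ, 0 < t → f t = c + ∫ s in (0 : ℝ)..t, g s) (k : ℝ) {T : ℝ} (hT : 0 < T) :
    -(∫ t in (0 : ℝ)..1, |g t * (f t + k)|) - 1 / 2 * (∫ t in (0 : ℝ)..1, (f t + k) ^ 2) ≤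
      ∫ t in (0 : ℝ)..T, g t * (f t + k) := by
  set G : ℝ → ℝ := fun t => ∫ s in (0 : ℝ)..t, g s with hG
  have hGc : Continuous G :=
    intervalIntegral.continuous_primitive (intervalIntegrable_of_locallyIntegrable hg) 0
  set F : ℝ → ℝ := fun t => c + k + G t with hF
  have hFc : Continuous F := by fun_prop
  have hzi : ∀ a b, IntervalIntegrable (fun t => g t * F t) volume a b := fun a b =>
    (intervalIntegrable_of_locallyIntegrable hg a b).mul_continuousOn hFc.continuousOn
  have hcongr : ∀ {E : ℝ → ℝ → ℝ} {t : ℝ}, 0 ≤ t →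
      ∫ s in (0 : ℝ)..t, E s (f s + k) = ∫ s in (0 : ℝ)..t, E s (F s) := by
    intro E t ht
    refine intervalIntegral.integral_congr_ae ?_
    filter_upwards [hfg] with s hs hst
    rw [uIoc_of_le ht] at hst
    rw [hs hst.1, hF]
    simp only
    congr 1; ring
  -- F is an absolutely continuous representative of f + k with derivative g, so g F is the
  -- derivative of F²/2.
  have hid : ∀ t, ∫ s in (0 : ℝ)..t, g s * F s = 1 / 2 * F t ^ 2 - 1 / 2 * F 0 ^ 2 := by
    intro t
    have acG := (intervalIntegrable_of_locallyIntegrable hg 0 t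
      ).absolutelyContinuousOnInterval_intervalIntegral (c := 0) (by simp)
    have acF : AbsolutelyContinuousOnInterval F 0 t :=
      (contDiff_const (c := c + k) |>.contDiffOn (s := uIcc 0 t)
        |>.absolutelyContinuousOnInterval).add acG
    have hI := acF.integral_deriv_mul_eq_sub acF
    have : ∫ s in (0 : ℝ)..t, deriv F s * F s + F s * deriv F s =
        ∫ s in (0 : ℝ)..t, 2 * (g s * F s) := by
      refine intervalIntegral.integral_congr_ae ?_
      filter_upwards [LocallyIntegrable.ae_hasDerivAt_integral hg] with s hs _
      rw [((hs 0).const_add (c + k)).deriv]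
      ring
    rw [this, intervalIntegral.integral_const_mul] at hI
    linarith
  rw [hcongr (E := fun s y => |g s * y|) zero_le_one, hcongr (E := fun s y => y ^ 2) zero_le_one,
    hcongr (E := fun s y => g s * y) hT.le]
  set A := ∫ t in (0 : ℝ)..1, |g t * F t| with hA
  -- The value F(0)² is traded for F(t)² with t ∈ [0, 1], at the cost A. Averaging over t then
  -- leaves only time integrals, which remain integrable in x when f and g are square integrable in
  -- space-time.
  have hlow : ∀ t ∈ Icc (0 : ℝ) 1, -A - 1 / 2 * F t ^ 2 ≤ ∫ s in (0 : ℝ)..T, g s * F s := by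
    intro t ht
    have h1 := hid T
    have h2 := hid t
    have h3 : -A ≤ ∫ s in (0 : ℝ)..t, g s * F s := by
      have h4 : |∫ s in (0 : ℝ)..t, g s * F s| ≤ ∫ s in (0 : ℝ)..t, |g s * F s| :=
        intervalIntegral.abs_integral_le_integral_abs ht.1
      have h5 : ∫ s in (0 : ℝ)..t, |g s * F s| ≤ A :=
        intervalIntegral.integral_mono_interval le_rfl ht.1 ht.2
          (Eventually.of_forall fun _ => abs_nonneg _) (hzi 0 1).abs
      linarith [neg_abs_le (∫ s in (0 : ℝ)..t, g s * F s)]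
    nlinarith [sq_nonneg (F T)]
  have hm := intervalIntegral.integral_mono_on (μ := volume) (zero_le_one (α := ℝ))
    (f := fun t => -A - 1 / 2 * F t ^ 2) (g := fun _ => ∫ s in (0 : ℝ)..T, g s * F s)
    (Continuous.intervalIntegrable (by fun_prop) _ _) (by simp) hlow
  rw [intervalIntegral.integral_sub (by simp) (Continuous.intervalIntegrable (by fun_prop) _ _),
    intervalIntegral.integral_const_mul] at hm
  simpa using hm

end Couette

/-! ### The kinetic energy inequality in space-time -/

namespace Couette

variable {L₁ L₃ : ℝ}

lemma memLp_comp_snd {α : Type*} [MeasurableSpace α] {μ : Measure α} [IsFiniteMeasure μ]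
    {k : Space → ℝ} (hk : MemLp k 2 (chan L₁ L₃)) :
    MemLp (fun z : α × Space => k z.2) 2 (μ.prod (chan L₁ L₃)) := hk.comp_snd μ

lemma MemL2LocL2.integrable_mul_spaceTime {f : ScalarField} (hf : MemL2LocL2 L₁ L₃ f)
    {η : ℝ × Space → ℝ} (hη : Continuous η) {b : ℝ} (hb : 0 < b)
    (h0 : ∀ t x, t ∉ Ioc 0 b → η (t, x) = 0) :
    Integrable (fun z => f z.1 z.2 * η z) (spaceTime L₁ L₃) := by
  have hK : IsCompact (Icc (0 : ℝ) b ×ˢ cell L₁ L₃) := isCompact_Icc.prod isCompact_cell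
  obtain ⟨C, hC⟩ := hK.exists_bound_of_continuousOn hη.continuousOn
  have hη2 : MemLp η 2 ((volume.restrict (Ioc (0 : ℝ) b)).prod (chan L₁ L₃)) := by
    refine MemLp.of_bound hη.aestronglyMeasurable C ?_
    rw [chan, Measure.prod_restrict]
    exact ae_restrict_of_forall_mem (measurableSet_Ioc.prod measurableSet_cell)
      fun z hz => hC z ⟨Ioc_subset_Icc_self hz.1, hz.2⟩
  have hi := (hf b hb).integrable_mul hη2
  have hm : (volume.restrict (Ioc (0 : ℝ) b)).prod (chan L₁ L₃) =
      (spaceTime L₁ L₃).restrict (Ioc (0 : ℝ) b ×ˢ univ) := by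
    have : Ioc (0 : ℝ) b ∩ Ioi 0 = Ioc 0 b := inter_eq_left.2 fun t ht => ht.1
    rw [spaceTime, ← Measure.prod_restrict, Measure.restrict_univ,
      Measure.restrict_restrict measurableSet_Ioc, this]
  rw [hm] at hi
  refine IntegrableOn.integrable_of_forall_notMem_eq_zero (s := Ioc (0 : ℝ) b ×ˢ univ) hi
    fun z hz => ?_
  rw [show z = (z.1, z.2) from rfl, h0 z.1 z.2 fun hm => hz ⟨hm, mem_univ _⟩, mul_zero]

/-- Test the weak time derivative with `timeCutoff` in t times an arbitrary test function of x, then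
remove the latter by the fundamental lemma. The exceptional null set of x depends on n, p and q. -/
lemma ae_integral_mul_bumpDiff_eq (h₁ : 0 < L₁) (h₃ : 0 < L₃) {f g : ScalarField}
    (hf : MemL2LocL2 L₁ L₃ f) (hg : MemL2LocL2 L₁ L₃ g) (h : HasWeakTimeDeriv L₁ L₃ f g)
    {n : ℕ} {p q : ℝ} (hp : 1 / ((n : ℝ) + 1) < p) (hq : 1 / ((n : ℝ) + 1) < q) :
    ∀ᵐ x ∂(chan L₁ L₃), ∫ t in Ioi (0 : ℝ), f t x * bumpDiff n p q t =
      -∫ t in Ioi (0 : ℝ), g t x * timeCutoff n p q t := by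
  set a : ℝ := min p q - 1 / ((n : ℝ) + 1) with ha
  set b : ℝ := max p q + 1 / ((n : ℝ) + 1) with hb
  have ha0 : 0 < a := sub_pos.2 (lt_min hp hq)
  have hn0 : 0 < 1 / ((n : ℝ) + 1) := by positivity
  have hb0 : 0 < b := by linarith [le_max_left p q]
  have hzθ : ∀ t, t ∉ Icc a b → timeCutoff n p q t = 0 := fun t => timeCutoff_eq_zero hp hq
  have hzκ : ∀ t, t ∉ Icc a b → bumpDiff n p q t = 0 := fun t => bumpDiff_eq_zero
  have hsub : ∀ t, t ∉ Ioc 0 b → t ∉ Icc a b := fun t ht hm => ht ⟨ha0.trans_le hm.1, hm.2⟩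
  have cθ := (contDiff_timeCutoff n p q).continuous
  have cκ := (contDiff_bumpDiff n p q).continuous
  have i1 := hf.integrable_mul_spaceTime (η := fun z => bumpDiff n p q z.1) (by fun_prop) hb0
    fun t x ht => hzκ t (hsub t ht)
  have i2 := hg.integrable_mul_spaceTime (η := fun z => timeCutoff n p q z.1) (by fun_prop) hb0
    fun t x ht => hzθ t (hsub t ht)
  have hJ := ae_eq_zero_of_forall_isTest h₁ h₃
    (J := fun x => ∫ t in Ioi (0 : ℝ), (f t x * bumpDiff n p q t + g t x * timeCutoff n p q t))
    (i1.add i2).integral_prod_right ?_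
  · filter_upwards [hJ, i1.prod_left_ae, i2.prod_left_ae] with x hx j1 j2
    rw [integral_add j1 j2] at hx
    linarith
  · intro φ hφ
    have cφ := hφ.smooth.continuous
    have i3 := hf.integrable_mul_spaceTime (η := fun z => bumpDiff n p q z.1 * φ z.2)
      (by fun_prop) hb0 fun t x ht => by simp [hzκ t (hsub t ht)]
    have i4 := hg.integrable_mul_spaceTime (η := fun z => timeCutoff n p q z.1 * φ z.2)
      (by fun_prop) hb0 fun t x ht => by simp [hzθ t (hsub t ht)]
    obtain ⟨r, hr, hs⟩ := hφ.support
    have hw := h (fun z => timeCutoff n p q z.1 * φ z.2)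
      ⟨((contDiff_timeCutoff n p q).comp contDiff_fst).mul (hφ.smooth.comp contDiff_snd),
        fun t x => by simp only [hφ.periodic₁], fun t x => by simp only [hφ.periodic₃],
        a, b, r, ha0, hr, fun t x hne => ⟨by
          by_contra hm
          exact hne (by simp [hzθ t hm]), hs x (right_ne_zero_of_mul hne)⟩⟩
    have hd : ∀ z : ℝ × Space, deriv (fun s => timeCutoff n p q s * φ z.2) z.1 =
        bumpDiff n p q z.1 * φ z.2 := by
      intro z
      rw [deriv_mul_const ((contDiff_timeCutoff n p q).differentiable (by simp) _),
        deriv_timeCutoff]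
    simp only [hd] at hw
    have hsum : ∫ z, (f z.1 z.2 * (bumpDiff n p q z.1 * φ z.2) +
        g z.1 z.2 * (timeCutoff n p q z.1 * φ z.2)) ∂(spaceTime L₁ L₃) = 0 := by
      rw [integral_add i3 i4, hw]; ring
    have i34 : Integrable (fun z : ℝ × Space => f z.1 z.2 * (bumpDiff n p q z.1 * φ z.2) +
        g z.1 z.2 * (timeCutoff n p q z.1 * φ z.2)) (spaceTime L₁ L₃) := i3.add i4
    rw [spaceTime, integral_prod_symm _ i34] at hsum
    refine Eq.trans ?_ hsum
    refine integral_congr_ae (Eventually.of_forall fun x => ?_)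
    simp only
    rw [← integral_mul_const]
    congr 1
    ext t
    ring

lemma MemL2LocL2.ae_locallyIntegrable {f : ScalarField} (hf : MemL2LocL2 L₁ L₃ f) :
    ∀ᵐ x ∂(chan L₁ L₃), LocallyIntegrable (indicator (Ioi (0 : ℝ)) fun t => f t x) := by
  have : ∀ n : ℕ, ∀ᵐ x ∂(chan L₁ L₃), IntegrableOn (fun t => f t x) (Ioc 0 ((n : ℝ) + 1)) :=
    fun n => ((hf ((n : ℝ) + 1) (by positivity)).integrable (by norm_num)).prod_left_ae
  filter_upwards [ae_all_iff.2 this] with x hx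
  refine locallyIntegrable_iff.2 fun K hK => ?_
  obtain ⟨R, hR⟩ := hK.isBounded.subset_closedBall 0
  obtain ⟨n, hn⟩ := exists_nat_ge R
  refine (IntegrableOn.mono_set ?_ hR)
  rw [Real.closedBall_eq_Icc, integrableOn_indicator_iff measurableSet_Ioi]
  refine (hx n).mono_set fun t ht => ⟨ht.1, ?_⟩
  have := ht.2.2
  linarith

/-- The energy inequality: the work of the weak time derivative is bounded below. -/
lemma exists_neg_le_integral_timeDeriv_mul (h₁ : 0 < L₁) (h₃ : 0 < L₃) {f g : ScalarField}
    (hf : MemL2LocL2 L₁ L₃ f) (hg : MemL2LocL2 L₁ L₃ g) (h : HasWeakTimeDeriv L₁ L₃ f g)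
    {k : Space → ℝ} (hk : MemLp k 2 (chan L₁ L₃)) :
    ∃ C, ∀ T, 0 < T → -C ≤ ∫ z, g z.1 z.2 * (f z.1 z.2 + k z.2)
      ∂((volume.restrict (Ioc (0 : ℝ) T)).prod (chan L₁ L₃)) := by
  have hfk : ∀ T, 0 < T → MemLp (fun z : ℝ × Space => f z.1 z.2 + k z.2) 2
      ((volume.restrict (Ioc (0 : ℝ) T)).prod (chan L₁ L₃)) :=
    fun T hT => (hf T hT).add (memLp_comp_snd hk)
  have hz : ∀ T, 0 < T → Integrable (fun z : ℝ × Space => g z.1 z.2 * (f z.1 z.2 + k z.2))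
      ((volume.restrict (Ioc (0 : ℝ) T)).prod (chan L₁ L₃)) :=
    fun T hT => (hg T hT).integrable_mul (hfk T hT)
  -- Rational centres make the family of time tests countable, so a single null set of x serves all
  -- of them.
  have hall : ∀ᵐ x ∂(chan L₁ L₃), ∀ (n : ℕ) (p q : ℚ), 1 / ((n : ℝ) + 1) < p →
      1 / ((n : ℝ) + 1) < q → ∫ t in Ioi (0 : ℝ), f t x * bumpDiff n p q t =
      -∫ t in Ioi (0 : ℝ), g t x * timeCutoff n p q t := by
    simp only [ae_all_iff]
    intro n p q hp hq
    exact ae_integral_mul_bumpDiff_eq h₁ h₃ hf hg h hp hq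
  have hx : ∀ᵐ x ∂(chan L₁ L₃), ∀ T, 0 < T →
      -(∫ t in Ioc (0 : ℝ) 1, |g t x * (f t x + k x)|) -
        1 / 2 * (∫ t in Ioc (0 : ℝ) 1, (f t x + k x) ^ 2) ≤
      ∫ t in Ioc (0 : ℝ) T, g t x * (f t x + k x) := by
    filter_upwards [hall, hf.ae_locallyIntegrable, hg.ae_locallyIntegrable] with x hx lf lg T hT
    obtain ⟨c, hc⟩ := exists_ae_eq_const_add_primitive lf lg fun n p q hp hq => by
      have := hx n p q hp hq
      rw [← integral_indicator measurableSet_Ioi, ← integral_indicator measurableSet_Ioi] at this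
      simpa only [indicator_mul_left] using this
    have hmain := neg_le_intervalIntegral_mul lg hc (k x) hT
    have hcg : ∀ (E : ℝ → ℝ → ℝ) (T : ℝ), 0 ≤ T →
        ∫ t in (0 : ℝ)..T, E (indicator (Ioi 0) (fun t => g t x) t)
          (indicator (Ioi 0) (fun t => f t x) t) = ∫ t in Ioc (0 : ℝ) T, E (g t x) (f t x) := by
      intro E T hT
      rw [intervalIntegral.integral_of_le hT]
      refine setIntegral_congr_fun measurableSet_Ioc fun t ht => ?_
      simp only [indicator_of_mem (show t ∈ Ioi (0 : ℝ) from ht.1)]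
    rw [hcg (fun a b => |a * (b + k x)|) 1 zero_le_one, hcg (fun a b => (b + k x) ^ 2) 1 zero_le_one,
      hcg (fun a b => a * (b + k x)) T hT.le] at hmain
    exact hmain
  have iA := (hz 1 one_pos).abs
  have iB := (hfk 1 one_pos).integrable_sq
  -- The constant involves only the time interval (0, 1], hence does not depend on T.
  refine ⟨(∫ x, ∫ t in Ioc (0 : ℝ) 1, |g t x * (f t x + k x)| ∂volume ∂(chan L₁ L₃)) +
    1 / 2 * ∫ x, ∫ t in Ioc (0 : ℝ) 1, (f t x + k x) ^ 2 ∂volume ∂(chan L₁ L₃), fun T hT => ?_⟩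
  have jA : Integrable (fun x => -∫ t in Ioc (0 : ℝ) 1, |g t x * (f t x + k x)|)
    (chan L₁ L₃) := iA.integral_prod_right.neg
  have jB : Integrable (fun x => 1 / 2 * ∫ t in Ioc (0 : ℝ) 1, (f t x + k x) ^ 2)
    (chan L₁ L₃) := iB.integral_prod_right.const_mul _
  rw [integral_prod_symm _ (hz T hT), neg_add, ← sub_eq_add_neg, ← integral_neg,
    ← integral_const_mul, ← integral_sub jA jB]
  refine integral_mono_ae (jA.sub jB) (hz T hT).integral_prod_right ?_
  filter_upwards [hx] with x hx
  exact hx T hT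

end Couette

/-! ### Construction of the boundary layer profile -/

namespace Couette

lemma intervalIntegral_eq_integral_of_support {F : ℝ → ℝ} {a b : ℝ} (hab : a ≤ b)
    (hF : ∀ y, y ∉ Icc a b → F y = 0) : ∫ y in a..b, F y = ∫ y, F y := by
  rw [intervalIntegral.integral_of_le hab, ← integral_Icc_eq_integral_Ioc,
    setIntegral_eq_integral_of_forall_compl_eq_zero fun y hy => hF y hy]

/-- The reflection y ↦ 2c - y preserves the bump and changes the sign of y - c. -/
lemma integral_normed_mul_sub {c : ℝ} (b : ContDiffBump c) :
    ∫ y, b.normed volume y * (y - c) = 0 := by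
  have h := integral_sub_left_eq_self (fun y => b.normed volume y * (y - c)) volume (2 * c)
  have e : ∀ y, b.normed volume (2 * c - y) * (2 * c - y - c) =
      -(b.normed volume y * (y - c)) := by
    intro y
    have := b.normed_sub (μ := volume) (y - c)
    rw [show c - (y - c) = 2 * c - y by ring, show c + (y - c) = y by ring] at this
    rw [this]; ring
  simp only [e, integral_neg] at h
  linarith

/-- A smooth background correction: `y - ψ y` is concentrated in a layer of width `δ` at the
lower wall. -/
lemma exists_boundary_layer {δ : ℝ} (h0 : 0 < δ) (h1 : δ ≤ 1 / 4) :
    ∃ ψ : ℝ → ℝ, ContDiff ℝ ∞ ψ ∧ (∃ r < (1 / 2 : ℝ), ∀ y, ψ y ≠ 0 → |y| ≤ r) ∧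
      (∀ y, deriv ψ y ≤ 1) ∧
      (∫ y in (-1 / 2 : ℝ)..(1 / 2), deriv ψ y ^ 2) ≤ 1 + 5 / 4 / δ ∧
      (∫ y in (-1 / 2 : ℝ)..(1 / 2), (1 - deriv ψ y) * (1 / 2 - |y|)) ≤ 51 / 100 * δ := by
  -- The bump b, centred at distance δ/2 from the lower wall, carries the jump of the background;
  -- its first moment about the wall is therefore δ/2. The plateau η equals 1 except within δ/100 of
  -- the walls. Both supports stay strictly inside the channel.
  set c : ℝ := -1 / 2 + δ / 2 with hc
  let b : ContDiffBump c := ⟨2 / 5 * δ, 9 / 20 * δ, by positivity, by linarith⟩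
  let η : ContDiffBump (0 : ℝ) := ⟨1 / 2 - δ / 100, 1 / 2 - δ / 200, by linarith, by linarith⟩
  set B : ℝ → ℝ := b.normed volume with hB
  set R : ℝ := 1 / 2 - δ / 200 with hR
  have hR2 : R < 1 / 2 := by linarith
  have hBc : Continuous B := b.continuous_normed
  have hηc : Continuous η := η.continuous
  have hB0 : ∀ y, 0 ≤ B y := fun y => b.nonneg_normed y
  have hη0 : ∀ y, 0 ≤ η y := fun y => η.nonneg
  have hη1 : ∀ y, η y ≤ 1 := fun y => η.le_one
  have hBs : ∀ y, y ∉ Icc (-R) R → B y = 0 := by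
    intro y hy
    by_contra hne
    have : y ∈ Metric.ball c b.rOut := by
      rw [← b.support_normed_eq (μ := volume)]; exact hne
    rw [Metric.mem_ball, Real.dist_eq, abs_lt] at this
    have hr : b.rOut = 9 / 20 * δ := rfl
    rw [hr] at this
    exact hy ⟨by linarith [this.1], by linarith [this.2]⟩
  have hηs : ∀ y, y ∉ Icc (-R) R → η y = 0 := by
    intro y hy
    refine η.zero_of_le_dist ?_
    rw [Real.dist_eq, sub_zero]
    by_contra hlt
    exact hy (abs_le.1 (not_le.1 hlt).le)
  have hwide : ∀ y, y ∉ Icc (-1 / 2 : ℝ) (1 / 2) → y ∉ Icc (-R) R := fun y hy hm =>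
    hy ⟨by linarith [hm.1], by linarith [hm.2]⟩
  have hBi : Integrable B := b.integrable_normed
  have hB1 : ∫ y in (-1 / 2 : ℝ)..(1 / 2), B y = 1 := by
    rw [intervalIntegral_eq_integral_of_support (by norm_num) fun y hy => hBs y (hwide y hy)]
    exact b.integral_normed
  have hBm : ∫ y in (-1 / 2 : ℝ)..(1 / 2), B y * (1 / 2 + y) = δ / 2 := by
    rw [intervalIntegral_eq_integral_of_support (by norm_num) fun y hy => by
      rw [hBs y (hwide y hy), zero_mul]]
    have e : ∀ y, B y * (1 / 2 + y) = B y * (y - c) + δ / 2 * B y := fun y => by rw [hc]; ring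
    have i1 : Integrable fun y => B y * (y - c) :=
      (hBc.mul (by fun_prop)).integrable_of_hasCompactSupport
        (b.hasCompactSupport_normed.mul_right)
    simp only [e]
    rw [integral_add i1 (hBi.const_mul _), integral_const_mul]
    have h2 : ∫ y, B y = 1 := b.integral_normed
    have h3 : ∫ y, B y * (y - c) = 0 := integral_normed_mul_sub b
    rw [h2, h3]; ring
  set κ : ℝ := ∫ y, η y with hκ
  have hκ0 : 0 ≤ κ := integral_nonneg hη0
  have hκ1 : κ ≤ 1 := by
    rw [hκ, ← intervalIntegral_eq_integral_of_support (a := -1 / 2) (b := 1 / 2) (by norm_num)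
      fun y hy => hηs y (hwide y hy)]
    refine (intervalIntegral.integral_mono_on (by norm_num) (hηc.intervalIntegrable _ _)
      (intervalIntegrable_const (c := (1 : ℝ))) fun y _ => hη1 y).trans ?_
    norm_num
  -- The future ψ'. The factor κ = ∫η makes its integral zero, so that ψ vanishes near both walls.
  set h : ℝ → ℝ := fun y => η y - κ * B y with hh
  have hhs : ContDiff ℝ ∞ h := (η.contDiff (n := ⊤)).sub
    (contDiff_const.mul (b.contDiff_normed (n := ⊤)))
  have hh0 : ∫ y, h y = 0 := by
    have h2 : ∫ y, B y = 1 := b.integral_normed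
    rw [hh, integral_sub η.integrable (hBi.const_mul _), integral_const_mul, h2]
    simp [hκ]
  have hd : deriv (fun t => ∫ s in (-1 / 2 : ℝ)..t, h s) = h := deriv_primitive hhs.continuous _
  have hBsup : ∀ y, B y ≤ 5 / 4 / δ := by
    intro y
    refine (b.normed_le_div_measure_closedBall_rIn volume y).trans (le_of_eq ?_)
    have hr : b.rIn = 2 / 5 * δ := rfl
    rw [hr, Real.volume_real_closedBall (by positivity)]
    field_simp; norm_num
  have hcont : Continuous h := hhs.continuous
  refine ⟨fun t => ∫ s in (-1 / 2 : ℝ)..t, h s, contDiff_primitive hhs _,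
    ⟨R, hR2, fun y hy => ?_⟩, fun y => ?_, ?_, ?_⟩
  · by_contra hlt
    exact hy (primitive_eq_zero (a := -R) (b := R) hhs.continuous (by linarith)
      (fun s hs => by simp [hh, hηs s hs, hBs s hs]) hh0 fun hm => hlt (abs_le.2 hm))
  · rw [hd]
    have := mul_nonneg hκ0 (hB0 y)
    simp only [hh]
    linarith [hη1 y]
  · rw [hd]
    have hle : ∀ y ∈ Icc (-1 / 2 : ℝ) (1 / 2), h y ^ 2 ≤ 1 + 5 / 4 / δ * B y := by
      intro y _
      -- The cross term -2κηB is nonpositive and is dropped.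
      have e1 : h y ^ 2 ≤ η y ^ 2 + (κ * B y) ^ 2 := by
        have := mul_nonneg (hη0 y) (mul_nonneg hκ0 (hB0 y))
        simp only [hh]; nlinarith
      have e2 : η y ^ 2 ≤ 1 := pow_le_one₀ (hη0 y) (hη1 y)
      have e3 : (κ * B y) ^ 2 ≤ B y ^ 2 := by
        refine pow_le_pow_left₀ (mul_nonneg hκ0 (hB0 y)) ?_ 2
        exact mul_le_of_le_one_left (hB0 y) hκ1
      have e4 : B y ^ 2 ≤ 5 / 4 / δ * B y := by
        rw [pow_two]; exact mul_le_mul_of_nonneg_right (hBsup y) (hB0 y)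
      linarith
    refine (intervalIntegral.integral_mono_on (by norm_num)
      ((hcont.pow 2).intervalIntegrable _ _)
      (Continuous.intervalIntegrable (by fun_prop) _ _) hle).trans (le_of_eq ?_)
    rw [intervalIntegral.integral_add (by simp) (Continuous.intervalIntegrable (by fun_prop) _ _),
      intervalIntegral.integral_const_mul, hB1]
    norm_num
  · rw [hd]
    have hle : ∀ y ∈ Icc (-1 / 2 : ℝ) (1 / 2),
        (1 - h y) * (1 / 2 - |y|) ≤ δ / 100 + B y * (1 / 2 + y) := by
      intro y hy
      have hm0 : 0 ≤ 1 / 2 - |y| := by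
        have : |y| ≤ 1 / 2 := abs_le.2 ⟨by linarith [hy.1], hy.2⟩
        linarith
      have hm1 : 1 / 2 - |y| ≤ 1 / 2 + y := by linarith [neg_abs_le y]
      -- Where η differs from 1, the distance to the wall is below δ/100. With the moment δ/2 of B
      -- this accounts for the constant 51/100.
      have e1 : (1 - η y) * (1 / 2 - |y|) ≤ δ / 100 := by
        by_cases hyy : |y| ≤ 1 / 2 - δ / 100
        · have : η y = 1 := η.one_of_mem_closedBall (by
            rw [Metric.mem_closedBall, Real.dist_eq, sub_zero]; exact hyy)
          rw [this]; simp only [sub_self, zero_mul]; positivity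
        · have := hη0 y
          have := hη1 y
          nlinarith
      have e2 : κ * B y * (1 / 2 - |y|) ≤ B y * (1 / 2 + y) :=
        mul_le_mul (mul_le_of_le_one_left (hB0 y) hκ1) hm1 hm0 (hB0 y)
      simp only [hh]
      linarith
    refine (intervalIntegral.integral_mono_on (by norm_num)
      (Continuous.intervalIntegrable (by fun_prop) _ _)
      (Continuous.intervalIntegrable (by fun_prop) _ _) hle).trans (le_of_eq ?_)
    rw [intervalIntegral.integral_add (by simp) (Continuous.intervalIntegrable (by fun_prop) _ _),
      hBm, intervalIntegral.integral_const]
    norm_num; ring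

lemma integral_half_sub_abs : ∫ y in (-1 / 2 : ℝ)..(1 / 2), (1 / 2 - |y|) = 1 / 4 := by
  have hi : ∀ a b : ℝ, IntervalIntegrable (fun y : ℝ => 1 / 2 - |y|) volume a b := fun a b =>
    Continuous.intervalIntegrable (by fun_prop) _ _
  rw [← intervalIntegral.integral_add_adjacent_intervals (hi (-1 / 2) 0) (hi 0 (1 / 2))]
  have e1 : ∫ y in (-1 / 2 : ℝ)..0, (1 / 2 - |y|) = ∫ y in (-1 / 2 : ℝ)..0, (1 / 2 + y) :=
    intervalIntegral.integral_congr fun y hy => by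
      rw [uIcc_of_le (by norm_num)] at hy
      simp only [abs_of_nonpos hy.2]; ring
  have e2 : ∫ y in (0 : ℝ)..(1 / 2), (1 / 2 - |y|) = ∫ y in (0 : ℝ)..(1 / 2), (1 / 2 - y) :=
    intervalIntegral.integral_congr fun y hy => by
      rw [uIcc_of_le (by norm_num)] at hy
      simp only [abs_of_nonneg hy.1]
  rw [e1, e2, intervalIntegral.integral_add (by simp) (by simp),
    intervalIntegral.integral_sub (by simp) (by simp), integral_id, integral_id]
  norm_num

end Couette

/-! ### Testing the momentum equation against the background deviation -/

namespace Couette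

variable {L₁ L₃ : ℝ}

lemma MemH10.add_isTest (h₁ : 0 < L₁) (h₃ : 0 < L₃) {f χ : Space → ℝ} {g : Fin 3 → Space → ℝ}
    (hf : MemH10 L₁ L₃ f g) (hχ : IsTest L₁ L₃ χ) :
    MemH10 L₁ L₃ (fun x => f x + χ x) (fun j x => g j x + partialDeriv j χ x) := by
  have hχ' := hχ.memH10 h₁ h₃
  refine ⟨⟨hf.1.1.add hχ'.1.1, fun j => (hf.1.2.1 j).add (hχ'.1.2.1 j), fun φ hφ j => ?_⟩,
    fun ε hε => ?_⟩
  · have m1 : MemLp φ 2 (chan L₁ L₃) := memLp_of_continuous hφ.smooth.continuous 2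
    have m2 : MemLp (partialDeriv j φ) 2 (chan L₁ L₃) :=
      memLp_of_continuous (continuous_partialDeriv hφ.smooth j) 2
    have e1 := hf.1.2.2 φ hφ j
    have e2 := hχ'.1.2.2 φ hφ j
    have i1 : Integrable (fun x => f x * partialDeriv j φ x) (chan L₁ L₃) :=
      hf.1.1.integrable_mul m2
    have i2 : Integrable (fun x => χ x * partialDeriv j φ x) (chan L₁ L₃) :=
      hχ'.1.1.integrable_mul m2
    have i3 : Integrable (fun x => g j x * φ x) (chan L₁ L₃) := (hf.1.2.1 j).integrable_mul m1
    have i4 : Integrable (fun x => partialDeriv j χ x * φ x) (chan L₁ L₃) :=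
      (hχ'.1.2.1 j).integrable_mul m1
    simp only [add_mul]
    rw [integral_add i1 i2, integral_add i3 i4, e1, e2]
    ring
  · obtain ⟨φ, hφ, k1, k2⟩ := hf.2 ε hε
    have hd : ∀ j x, partialDeriv j (fun x => φ x + χ x) x =
        partialDeriv j φ x + partialDeriv j χ x := by
      intro j x
      unfold partialDeriv
      rw [fderiv_fun_add (hφ.smooth.differentiable (by simp) x)
        (hχ.smooth.differentiable (by simp) x)]
      rfl
    refine ⟨fun x => φ x + χ x, ⟨hφ.smooth.add hχ.smooth,
      fun x => by rw [hφ.periodic₁, hχ.periodic₁], fun x => by rw [hφ.periodic₃, hχ.periodic₃], ?_⟩,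
      by simpa using k1, fun j => by simpa [hd] using k2 j⟩
    obtain ⟨r, hr, s1⟩ := hφ.support
    obtain ⟨r', hr', s2⟩ := hχ.support
    refine ⟨max r r', max_lt hr hr', fun x hx => ?_⟩
    by_cases h : φ x = 0
    · exact (s2 x fun h' => hx (by simp [h, h'])).trans (le_max_right _ _)
    · exact (s1 x h).trans (le_max_left _ _)

/-- A smooth function of the wall-normal variable vanishing near the walls. -/
structure IsProfile (ψ : ℝ → ℝ) : Prop where
  smooth : ContDiff ℝ ∞ ψ
  support : ∃ r < (1 / 2 : ℝ), ∀ y, ψ y ≠ 0 → |y| ≤ r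

lemma IsProfile.isTest {ψ : ℝ → ℝ} (hψ : IsProfile ψ) : IsTest L₁ L₃ (fun x => ψ (x 1)) := by
  obtain ⟨r, hr, hs⟩ := hψ.support
  have := isPeriodicSmooth_wallNormal (L₁ := L₁) (L₃ := L₃) hψ.smooth
  exact ⟨this.smooth, this.periodic₁, this.periodic₃, r, hr, fun x => hs _⟩

lemma continuous_deriv_of_smooth {ψ : ℝ → ℝ} (hψ : ContDiff ℝ ∞ ψ) : Continuous (deriv ψ) :=
  hψ.continuous_deriv (by simp)

/-- Minus the background profile `(x₂ - ψ(x₂)) e₁`. -/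
def shift (ψ : ℝ → ℝ) (i : Fin 3) (x : Space) : ℝ := if i = 0 then ψ (x 1) - x 1 else 0

lemma continuous_shift {ψ : ℝ → ℝ} (hψ : Continuous ψ) (i : Fin 3) : Continuous (shift ψ i) := by
  unfold shift
  split_ifs
  · fun_prop
  · exact continuous_const

lemma memH10_add_shift (h₁ : 0 < L₁) (h₃ : 0 < L₃) {ψ : ℝ → ℝ} (hψ : IsProfile ψ)
    {u : Fin 3 → Space → ℝ} {Du : Fin 3 → Fin 3 → Space → ℝ} (hu : ∀ i, MemH10 L₁ L₃
      (fun x => u i x - laminar i x) (fun j x => Du i j x - laminarGrad i j)) (i : Fin 3) :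
    MemH10 L₁ L₃ (fun x => u i x + shift ψ i x)
      (fun j x => Du i j x - laminarGrad i j * (1 - deriv ψ (x 1))) := by
  by_cases hi : i = 0
  · subst hi
    have := (hu 0).add_isTest h₁ h₃ hψ.isTest
    simp only [partialDeriv_wallNormal hψ.smooth] at this
    convert this using 2 with x j
    · simp [shift, laminar]; ring
    · ext x
      by_cases hj : j = 1
      · simp [laminarGrad, hj]; ring
      · simp [laminarGrad, hj]
  · have := hu i
    simp only [laminar, laminarGrad, hi, false_and, if_false] at this
    simpa only [shift, laminarGrad, hi, false_and, if_false, zero_mul, add_zero, sub_zero] using this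

/-- The wall-normal flux of a divergence-free field with Couette boundary values vanishes. -/
lemma integral_wallNormal_mul_eq_zero (h₁ : 0 < L₁) (h₃ : 0 < L₃) {U : Fin 3 → Space → ℝ}
    {DU : Fin 3 → Fin 3 → Space → ℝ} (hU : ∀ i, MemH10 L₁ L₃ (fun x => U i x - laminar i x)
      (fun j x => DU i j x - laminarGrad i j))
    (hdiv : ∀ᵐ x ∂(chan L₁ L₃), ∑ i, DU i i x = 0) {ζ : ℝ → ℝ} (hζ : ContDiff ℝ ∞ ζ) :
    ∫ x, ζ (x 1) * U 1 x ∂(chan L₁ L₃) = 0 := by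
  -- Integrate Z(x₂) ∇·U = 0 by parts: the tangential derivatives of Z vanish and its normal
  -- derivative is ζ. The diagonal of `laminarGrad` is zero, so subtracting the laminar flow does
  -- not alter the divergence.
  set Z : ℝ → ℝ := fun t => ∫ s in (0 : ℝ)..t, ζ s with hZ
  have hZs : ContDiff ℝ ∞ Z := contDiff_primitive hζ 0
  have hp := isPeriodicSmooth_wallNormal (L₁ := L₁) (L₃ := L₃) hZs
  have hw := hp.hasWeakGrad h₁ h₃
  have hZm : MemLp (fun x : Space => Z (x 1)) 2 (chan L₁ L₃) :=
    memLp_of_continuous hp.smooth.continuous 2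
  have hI := fun j => hw.integral_mul_eq_neg hZm j
    (memLp_of_continuous (continuous_partialDeriv hp.smooth j) 2) (hU j)
  have hZd : deriv Z = ζ := deriv_primitive hζ.continuous 0
  simp only [partialDeriv_wallNormal hZs, hZd] at hI
  have h1 := hI 1
  have h0 := hI 0
  have h2 := hI 2
  simp only [if_true, laminar, laminarGrad, one_ne_zero, if_false, false_and, sub_zero] at h1
  simp [laminar, laminarGrad] at h0 h2
  have hs : ∫ x, Z (x 1) * ∑ i, DU i i x ∂(chan L₁ L₃) = 0 := by
    refine integral_eq_zero_of_ae ?_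
    filter_upwards [hdiv] with x hx
    simp [hx]
  have hm : ∀ i, MemLp (fun x => DU i i x) 2 (chan L₁ L₃) := by
    intro i
    have := (hU i).1.2.1 i
    have e : laminarGrad i i = 0 := by fin_cases i <;> simp [laminarGrad]
    simpa [e] using this
  have hi : ∀ i ∈ Finset.univ, Integrable (fun x => Z (x 1) * DU i i x) (chan L₁ L₃) :=
    fun i _ => hZm.integrable_mul (hm i)
  simp only [Finset.mul_sum] at hs
  rw [integral_finsetSum _ hi, Fin.sum_univ_three] at hs
  linarith

lemma integral_grad_eq_zero (h₁ : 0 < L₁) (h₃ : 0 < L₃) {a : Space → ℝ} {Da : Fin 3 → Space → ℝ}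
    (ha : MemH10 L₁ L₃ a Da) (j : Fin 3) : ∫ x, Da j x ∂(chan L₁ L₃) = 0 := by
  have hp := isPeriodicSmooth_wallNormal (L₁ := L₁) (L₃ := L₃) (contDiff_const (c := (1 : ℝ)))
  have := (hp.hasWeakGrad h₁ h₃).integral_mul_eq_neg (memLp_of_continuous continuous_const 2) j
    (memLp_of_continuous (continuous_partialDeriv hp.smooth j) 2) ha
  simp only [partialDeriv_wallNormal (contDiff_const (c := (1 : ℝ))), deriv_const] at this
  simpa using this

/-- The momentum equation tested with the deviation from a background profile. -/
lemma integral_momentum (h₁ : 0 < L₁) (h₃ : 0 < L₃) {ν M : ℝ} {ψ : ℝ → ℝ} (hψ : IsProfile ψ)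
    {U u d Dp : Fin 3 → Space → ℝ} {DU Du : Fin 3 → Fin 3 → Space → ℝ}
    {D2 : Fin 3 → Fin 3 → Fin 3 → Space → ℝ} {p : Space → ℝ}
    (hU : ∀ i, MemH1 L₁ L₃ (U i) (DU i)) (hM : ∀ i, ∀ᵐ x ∂(chan L₁ L₃), |U i x| ≤ M)
    (hdivU : ∀ᵐ x ∂(chan L₁ L₃), ∑ i, DU i i x = 0)
    (hdivu : ∀ᵐ x ∂(chan L₁ L₃), ∑ i, Du i i x = 0)
    (hu : ∀ i, MemH10 L₁ L₃ (fun x => u i x - laminar i x)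
      (fun j x => Du i j x - laminarGrad i j))
    (hDu : ∀ i j, MemH1 L₁ L₃ (Du i j) (D2 i j)) (hp : MemH1 L₁ L₃ p Dp)
    (hmom : ∀ i, ∀ᵐ x ∂(chan L₁ L₃), d i x + ∑ j, U j x * Du i j x =
      -Dp i x + ν * ∑ j, D2 i j j x) :
    ∑ i, ∫ x, d i x * (u i x + shift ψ i x) ∂(chan L₁ L₃) =
      -(∫ x, ((1 - deriv ψ (x 1)) * U 1 x) * (u 0 x + shift ψ 0 x) ∂(chan L₁ L₃)) -
      ν * ∑ i, ∑ j, ∫ x, Du i j x * (Du i j x - laminarGrad i j * (1 - deriv ψ (x 1)))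
        ∂(chan L₁ L₃) := by
  have hv := memH10_add_shift h₁ h₃ hψ hu
  set v : Fin 3 → Space → ℝ := fun i x => u i x + shift ψ i x with hvdef
  set Dv : Fin 3 → Fin 3 → Space → ℝ := fun i j x =>
    Du i j x - laminarGrad i j * (1 - deriv ψ (x 1)) with hDvdef
  have hv' : ∀ i, MemH10 L₁ L₃ (v i) (Dv i) := hv
  have hvm : ∀ i, MemLp (v i) 2 (chan L₁ L₃) := fun i => (hv' i).1.1
  have hDvm : ∀ i j, MemLp (Dv i j) 2 (chan L₁ L₃) := fun i j => (hv' i).1.2.1 j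
  have hUD : ∀ j (F : Space → ℝ), MemLp F 2 (chan L₁ L₃) →
      MemLp (fun x => U j x * F x) 2 (chan L₁ L₃) := fun j F hF =>
    MemLp.mul (p := ∞) (q := 2) (r := 2) hF (memLp_top_of_bound (hU j).1.1 M (hM j))
  have i1 : ∀ i j, Integrable (fun x => (U j x * Du i j x) * v i x) (chan L₁ L₃) := fun i j =>
    (hUD j _ (hDu i j).1).integrable_mul (hvm i)
  have i2 : ∀ i, Integrable (fun x => Dp i x * v i x) (chan L₁ L₃) := fun i =>
    (hp.2.1 i).integrable_mul (hvm i)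
  have i3 : ∀ i j, Integrable (fun x => D2 i j j x * v i x) (chan L₁ L₃) := fun i j =>
    ((hDu i j).2.1 j).integrable_mul (hvm i)
  have hi : ∀ i, ∫ x, d i x * v i x ∂(chan L₁ L₃) =
      -(∑ j, ∫ x, (U j x * Du i j x) * v i x ∂(chan L₁ L₃)) -
        (∫ x, Dp i x * v i x ∂(chan L₁ L₃)) +
        ν * ∑ j, ∫ x, D2 i j j x * v i x ∂(chan L₁ L₃) := by
    intro i
    have s1 : Integrable (fun x => ∑ j, (U j x * Du i j x) * v i x) (chan L₁ L₃) :=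
      integrable_finsetSum _ fun j _ => i1 i j
    have s3 : Integrable (fun x => ∑ j, D2 i j j x * v i x) (chan L₁ L₃) :=
      integrable_finsetSum _ fun j _ => i3 i j
    have s1n : Integrable (fun x => -∑ j, (U j x * Du i j x) * v i x) (chan L₁ L₃) := s1.neg
    have s12 : Integrable (fun x => -(∑ j, (U j x * Du i j x) * v i x) - Dp i x * v i x)
      (chan L₁ L₃) := s1n.sub (i2 i)
    rw [← integral_finsetSum _ fun j _ => i1 i j, ← integral_finsetSum _ fun j _ => i3 i j,
      ← integral_neg, ← integral_sub s1n (i2 i), ← integral_const_mul,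
      ← integral_add s12 (s3.const_mul ν)]
    refine integral_congr_ae ?_
    filter_upwards [hmom i] with x hx
    have : d i x = -(∑ j, U j x * Du i j x) - Dp i x + ν * ∑ j, D2 i j j x := by linarith
    simp only [← Finset.sum_mul]
    rw [this]; ring
  -- Split Du into Dv plus the gradient of the background. Antisymmetry with both arguments equal to
  -- v i shows that the Dv part contributes nothing.
  have htr : ∀ i, ∑ j, ∫ x, (U j x * Du i j x) * v i x ∂(chan L₁ L₃) =
      ∑ j, laminarGrad i j * ∫ x, ((1 - deriv ψ (x 1)) * U j x) * v i x ∂(chan L₁ L₃) := by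
    intro i
    have h0 := integral_transport_add_eq_zero (fun i => (hU i).1) (fun i j => (hU i).2.1 j)
      (fun i => (hU i).2.2) hM hdivU (hv' i) (hv' i)
    have e2 : ∀ j, ∫ x, (U j x * v i x) * Dv i j x ∂(chan L₁ L₃) =
        ∫ x, (U j x * Dv i j x) * v i x ∂(chan L₁ L₃) := fun j => by
      congr 1; ext x; ring
    simp only [e2, ← two_mul, ← Finset.mul_sum] at h0
    have h0' : ∑ j, ∫ x, (U j x * Dv i j x) * v i x ∂(chan L₁ L₃) = 0 := by linarith
    rw [← sub_eq_zero, ← Finset.sum_sub_distrib, ← h0']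
    refine Finset.sum_congr rfl fun j _ => ?_
    have cρ : Continuous fun x : Space => 1 - deriv ψ (x 1) :=
      continuous_const.sub ((continuous_deriv_of_smooth hψ.smooth).comp (continuous_apply 1))
    have i4 : Integrable (fun x => ((1 - deriv ψ (x 1)) * U j x) * v i x) (chan L₁ L₃) :=
      (memLp_continuous_mul (hU j).1 cρ).integrable_mul (hvm i)
    rw [← integral_const_mul, ← integral_sub (i1 i j) (i4.const_mul _)]
    congr 1; ext x; simp only [hDvdef]; ring
  -- The background gradient is off-diagonal, so v is divergence free along with u.
  have hpr : ∑ i, ∫ x, Dp i x * v i x ∂(chan L₁ L₃) = 0 := by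
    have : ∀ i, ∫ x, Dp i x * v i x ∂(chan L₁ L₃) = -∫ x, p x * Dv i i x ∂(chan L₁ L₃) :=
      fun i => hp.2.2.integral_mul_eq_neg hp.1 i (hp.2.1 i) (hv' i)
    have i5 : ∀ i ∈ Finset.univ, Integrable (fun x => p x * Dv i i x) (chan L₁ L₃) :=
      fun i _ => hp.1.integrable_mul (hDvm i i)
    rw [Finset.sum_congr rfl fun i _ => this i, Finset.sum_neg_distrib, ← integral_finsetSum _ i5,
      neg_eq_zero]
    refine integral_eq_zero_of_ae ?_
    filter_upwards [hdivu] with x hx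
    have e : ∀ i, Dv i i x = Du i i x := fun i => by
      fin_cases i <;> simp [hDvdef, laminarGrad]
    simp only [e, ← Finset.mul_sum, hx, mul_zero, Pi.zero_apply]
  have hvis : ∀ i j, ∫ x, D2 i j j x * v i x ∂(chan L₁ L₃) =
      -∫ x, Du i j x * Dv i j x ∂(chan L₁ L₃) := fun i j =>
    (hDu i j).2.2.integral_mul_eq_neg (hDu i j).1 j ((hDu i j).2.1 j) (hv' i)
  have hlam : ∀ F : Fin 3 → Fin 3 → ℝ, ∑ i, ∑ j, laminarGrad i j * F i j = F 0 1 := by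
    intro F; simp [Fin.sum_univ_three, laminarGrad]
  change ∑ i, ∫ x, d i x * v i x ∂(chan L₁ L₃) =
    -(∫ x, ((1 - deriv ψ (x 1)) * U 1 x) * v 0 x ∂(chan L₁ L₃)) -
      ν * ∑ i, ∑ j, ∫ x, Du i j x * Dv i j x ∂(chan L₁ L₃)
  simp only [hi, htr, hvis, Finset.sum_add_distrib, Finset.sum_sub_distrib, Finset.sum_neg_distrib,
    hpr, ← Finset.mul_sum, mul_neg]
  rw [hlam (fun i j => ∫ x, ((1 - deriv ψ (x 1)) * U j x) * v i x ∂(chan L₁ L₃))]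
  ring

end Couette

/-! ### The background inequality on a time slice -/

namespace Couette

variable {L₁ L₃ : ℝ}

/-- The weight of a background profile in the wall-normal Poincaré inequality. -/
noncomputable def layerWeight (ψ : ℝ → ℝ) : ℝ := ∫ y in (-1 / 2 : ℝ)..(1 / 2), (1 - deriv ψ y) * (1 / 2 - |y|)

lemma layerWeight_nonneg {ψ : ℝ → ℝ} (h : ∀ y, deriv ψ y ≤ 1) : 0 ≤ layerWeight ψ :=
  intervalIntegral.integral_nonneg (by norm_num) fun y hy => by
    have : |y| ≤ 1 / 2 := abs_le.2 ⟨by linarith [hy.1], hy.2⟩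
    exact mul_nonneg (by linarith [h y]) (by linarith)

lemma integral_one_chan (h₁ : 0 < L₁) (h₃ : 0 < L₃) :
    ∫ _, (1 : ℝ) ∂(chan L₁ L₃) = L₁ * L₃ := by
  have := integral_chan_wallNormal h₁ h₃ (Z := fun _ => 1) continuous_const
  rw [this]; norm_num

lemma laminarGrad_sq (i j : Fin 3) : laminarGrad i j ^ 2 = laminarGrad i j := by
  unfold laminarGrad; split_ifs <;> simp

lemma sum_laminarGrad_mul (F : Fin 3 → Fin 3 → ℝ) : ∑ i, ∑ j, laminarGrad i j * F i j = F 0 1 := by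
  simp [Fin.sum_univ_three, laminarGrad]

/-- Gradients of H¹₀ functions have mean zero, so the deviation from the constant matrix
`laminarGrad` is orthogonal to it in L²; the channel has volume L₁L₃. -/
lemma sum_integral_sq_sub (h₁ : 0 < L₁) (h₃ : 0 < L₃) {u : Fin 3 → Space → ℝ}
    {Du : Fin 3 → Fin 3 → Space → ℝ} (hu : ∀ i, MemH10 L₁ L₃ (fun x => u i x - laminar i x)
      (fun j x => Du i j x - laminarGrad i j)) :
    ∑ i, ∑ j, ∫ x, (Du i j x - laminarGrad i j) ^ 2 ∂(chan L₁ L₃) =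
      (∑ i, ∑ j, ∫ x, Du i j x ^ 2 ∂(chan L₁ L₃)) - L₁ * L₃ := by
  have h : ∀ i j, ∫ x, Du i j x ^ 2 ∂(chan L₁ L₃) =
      (∫ x, (Du i j x - laminarGrad i j) ^ 2 ∂(chan L₁ L₃)) + laminarGrad i j * (L₁ * L₃) := by
    intro i j
    have m := (hu i).1.2.1 j
    have hz := integral_grad_eq_zero h₁ h₃ (hu i) j
    have i1 := m.integrable_sq
    have i2 : Integrable (fun x => 2 * laminarGrad i j * (Du i j x - laminarGrad i j))
      (chan L₁ L₃) := (m.integrable (by norm_num)).const_mul _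
    have i3 : Integrable (fun _ : Space => laminarGrad i j * (1 : ℝ)) (chan L₁ L₃) :=
      integrable_const _
    have e : ∀ x, Du i j x ^ 2 = ((Du i j x - laminarGrad i j) ^ 2 +
        2 * laminarGrad i j * (Du i j x - laminarGrad i j)) + laminarGrad i j * 1 := by
      intro x
      have := laminarGrad_sq i j
      linear_combination this
    have i12 : Integrable (fun x => (Du i j x - laminarGrad i j) ^ 2 +
      2 * laminarGrad i j * (Du i j x - laminarGrad i j)) (chan L₁ L₃) := i1.add i2
    rw [integral_congr_ae (Eventually.of_forall e), integral_add i12 i3, integral_add i1 i2,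
      integral_const_mul, hz, integral_const_mul, integral_one_chan h₁ h₃]
    ring
  simp only [h, Finset.sum_add_distrib]
  rw [sum_laminarGrad_mul fun _ _ => L₁ * L₃]
  ring

/-- The energy inequality of the background method on a time slice. -/
lemma background_inequality (h₁ : 0 < L₁) (h₃ : 0 < L₃) {ν M : ℝ} (hν : 0 < ν) {ψ : ℝ → ℝ}
    (hψ : IsProfile ψ) (hψ1 : ∀ y, deriv ψ y ≤ 1) {P c q : ℝ} (hP : 0 ≤ P) (hq : 0 < q)
    (hPc : ∀ y z : ℝ, -(deriv ψ y * z) ≤ P * z ^ 2 + c * deriv ψ y ^ 2)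
    {U u d Dp : Fin 3 → Space → ℝ} {DU Du : Fin 3 → Fin 3 → Space → ℝ}
    {D2 : Fin 3 → Fin 3 → Fin 3 → Space → ℝ} {p : Space → ℝ}
    (hU : ∀ i, MemH1 L₁ L₃ (U i) (DU i)) (hM : ∀ i, ∀ᵐ x ∂(chan L₁ L₃), |U i x| ≤ M)
    (hdivU : ∀ᵐ x ∂(chan L₁ L₃), ∑ i, DU i i x = 0)
    (hdivu : ∀ᵐ x ∂(chan L₁ L₃), ∑ i, Du i i x = 0)
    (hUb : ∀ i, MemH10 L₁ L₃ (fun x => U i x - laminar i x)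
      (fun j x => DU i j x - laminarGrad i j))
    (hu : ∀ i, MemH10 L₁ L₃ (fun x => u i x - laminar i x)
      (fun j x => Du i j x - laminarGrad i j))
    (hDu : ∀ i j, MemH1 L₁ L₃ (Du i j) (D2 i j)) (hp : MemH1 L₁ L₃ p Dp)
    (hmom : ∀ i, ∀ᵐ x ∂(chan L₁ L₃), d i x + ∑ j, U j x * Du i j x =
      -Dp i x + ν * ∑ j, D2 i j j x) :
    ν * (1 - P) * ((∑ i, ∑ j, ∫ x, Du i j x ^ 2 ∂(chan L₁ L₃)) - L₁ * L₃) ≤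
      -(∑ i, ∫ x, d i x * (u i x + shift ψ i x) ∂(chan L₁ L₃)) +
      ν * c * (L₁ * L₃ * ∫ y in (-1 / 2 : ℝ)..(1 / 2), deriv ψ y ^ 2) +
      layerWeight ψ * (q * ((∑ i, ∑ j, ∫ x, Du i j x ^ 2 ∂(chan L₁ L₃)) - L₁ * L₃) +
        (1 / (4 * q)) * ((∑ i, ∑ j, ∫ x, DU i j x ^ 2 ∂(chan L₁ L₃)) - L₁ * L₃)) := by
  have hid := integral_momentum h₁ h₃ hψ hU hM hdivU hdivu hu hDu hp hmom
  rw [← sum_integral_sq_sub h₁ h₃ hu, ← sum_integral_sq_sub h₁ h₃ hUb, hid]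
  set Dw : Fin 3 → Fin 3 → Space → ℝ := fun i j x => Du i j x - laminarGrad i j with hDw
  set DW : Fin 3 → Fin 3 → Space → ℝ := fun i j x => DU i j x - laminarGrad i j with hDW
  have cψ' : Continuous fun x : Space => deriv ψ (x 1) :=
    (continuous_deriv_of_smooth hψ.smooth).comp (continuous_apply 1)
  have cψ : Continuous fun x : Space => ψ (x 1) := hψ.smooth.continuous.comp (continuous_apply 1)
  have mDw : ∀ i j, MemLp (Dw i j) 2 (chan L₁ L₃) := fun i j => (hu i).1.2.1 j
  have zDw : ∀ i j, ∫ x, Dw i j x ∂(chan L₁ L₃) = 0 := fun i j =>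
    integral_grad_eq_zero h₁ h₃ (hu i) j
  have zψ : ∫ x, deriv ψ (x 1) ∂(chan L₁ L₃) = 0 := by
    have := integral_partialDeriv_eq_zero h₁ h₃ (hψ.isTest (L₁ := L₁) (L₃ := L₃)) 1
    simpa only [partialDeriv_wallNormal hψ.smooth, if_true] using this
  have iψDw : ∀ i j, Integrable (fun x => deriv ψ (x 1) * Dw i j x) (chan L₁ L₃) := fun i j =>
    (memLp_continuous_mul (mDw i j) cψ').integrable (by norm_num)
  -- the viscous term
  have hvis : ∑ i, ∑ j, ∫ x, Du i j x * (Du i j x - laminarGrad i j * (1 - deriv ψ (x 1)))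
      ∂(chan L₁ L₃) = (∑ i, ∑ j, ∫ x, Dw i j x ^ 2 ∂(chan L₁ L₃)) +
        ∫ x, deriv ψ (x 1) * Dw 0 1 x ∂(chan L₁ L₃) := by
    have h : ∀ i j, ∫ x, Du i j x * (Du i j x - laminarGrad i j * (1 - deriv ψ (x 1)))
        ∂(chan L₁ L₃) = (∫ x, Dw i j x ^ 2 ∂(chan L₁ L₃)) +
          laminarGrad i j * ∫ x, deriv ψ (x 1) * Dw i j x ∂(chan L₁ L₃) := by
      intro i j
      -- The last two terms integrate to zero: Dw has mean zero, and so does ψ'.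
      have e : ∀ x, Du i j x * (Du i j x - laminarGrad i j * (1 - deriv ψ (x 1))) =
          ((Dw i j x ^ 2 + laminarGrad i j * (deriv ψ (x 1) * Dw i j x)) +
            laminarGrad i j * Dw i j x) + laminarGrad i j * deriv ψ (x 1) := by
        intro x
        have := laminarGrad_sq i j
        simp only [hDw]
        linear_combination deriv ψ (x 1) * this
      have j1 := (mDw i j).integrable_sq
      have j2 := (iψDw i j).const_mul (laminarGrad i j)
      have j3 := ((mDw i j).integrable (by norm_num)).const_mul (laminarGrad i j)
      have j4 : Integrable (fun x : Space => laminarGrad i j * deriv ψ (x 1)) (chan L₁ L₃) :=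
        (integrable_of_continuous cψ').const_mul _
      have j12 : Integrable (fun x => Dw i j x ^ 2 + laminarGrad i j * (deriv ψ (x 1) * Dw i j x))
        (chan L₁ L₃) := j1.add j2
      have j123 : Integrable (fun x => (Dw i j x ^ 2 +
        laminarGrad i j * (deriv ψ (x 1) * Dw i j x)) + laminarGrad i j * Dw i j x)
        (chan L₁ L₃) := j12.add j3
      rw [integral_congr_ae (Eventually.of_forall e), integral_add j123 j4, integral_add j12 j3,
        integral_add j1 j2]
      simp only [integral_const_mul, zDw, zψ]
      ring
    simp only [h, Finset.sum_add_distrib]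
    rw [sum_laminarGrad_mul fun i j => ∫ x, deriv ψ (x 1) * Dw i j x ∂(chan L₁ L₃)]
  -- the convective term
  have mw : MemLp (fun x => u 0 x - laminar 0 x) 2 (chan L₁ L₃) := (hu 0).1.1
  have cρ : Continuous fun x : Space => 1 - deriv ψ (x 1) := continuous_const.sub cψ'
  have hconv : ∫ x, ((1 - deriv ψ (x 1)) * U 1 x) * (u 0 x + shift ψ 0 x) ∂(chan L₁ L₃) =
      ∫ x, (1 - deriv ψ (x 1)) * U 1 x * (u 0 x - laminar 0 x) ∂(chan L₁ L₃) := by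
    -- With ζ = (1 - ψ')ψ the zero-flux identity removes the ψ part of v₁, leaving u₁ - x₂.
    have hz := integral_wallNormal_mul_eq_zero h₁ h₃ hUb hdivU
      (ζ := fun y => (1 - deriv ψ y) * ψ y)
      ((contDiff_const.sub ((contDiff_infty_iff_deriv.1 hψ.smooth).2)).mul hψ.smooth)
    have k1 : Integrable (fun x => (1 - deriv ψ (x 1)) * U 1 x * (u 0 x - laminar 0 x))
      (chan L₁ L₃) := (memLp_continuous_mul (hU 1).1 cρ).integrable_mul mw
    have k2 : Integrable (fun x => (1 - deriv ψ (x 1)) * ψ (x 1) * U 1 x)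
      (chan L₁ L₃) := (memLp_continuous_mul (hU 1).1 (cρ.mul cψ)).integrable (by norm_num)
    rw [← add_zero (∫ x, (1 - deriv ψ (x 1)) * U 1 x * (u 0 x - laminar 0 x) ∂(chan L₁ L₃)), ← hz,
      ← integral_add k1 k2]
    congr 1
    ext x
    simp only [shift, laminar, if_true]
    ring
  rw [hvis, hconv]
  have hsumw : ∀ F : Fin 3 → Fin 3 → Space → ℝ, ∀ a b,
      ∫ x, F a b x ^ 2 ∂(chan L₁ L₃) ≤ ∑ i, ∑ j, ∫ x, F i j x ^ 2 ∂(chan L₁ L₃) := by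
    intro F a b
    have n : ∀ i j, 0 ≤ ∫ x, F i j x ^ 2 ∂(chan L₁ L₃) := fun i j =>
      integral_nonneg fun x => sq_nonneg _
    exact (Finset.single_le_sum (f := fun j => ∫ x, F a j x ^ 2 ∂(chan L₁ L₃))
      (fun j _ => n a j) (Finset.mem_univ b)).trans
      (Finset.single_le_sum (f := fun i => ∑ j, ∫ x, F i j x ^ 2 ∂(chan L₁ L₃))
      (fun i _ => Finset.sum_nonneg fun j _ => n i j) (Finset.mem_univ a))
  have hA : -∫ x, deriv ψ (x 1) * Dw 0 1 x ∂(chan L₁ L₃) ≤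
      P * (∑ i, ∑ j, ∫ x, Dw i j x ^ 2 ∂(chan L₁ L₃)) +
        c * (L₁ * L₃ * ∫ y in (-1 / 2 : ℝ)..(1 / 2), deriv ψ y ^ 2) := by
    have k1 := ((mDw 0 1).integrable_sq).const_mul P
    have k2 : Integrable (fun x : Space => c * deriv ψ (x 1) ^ 2) (chan L₁ L₃) :=
      (integrable_of_continuous (cψ'.pow 2)).const_mul c
    have := integral_mono (iψDw 0 1).neg (k1.add k2) fun x => hPc (x 1) (Dw 0 1 x)
    simp only [Pi.neg_apply, Pi.add_apply, integral_neg] at this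
    rw [integral_add k1 k2, integral_const_mul, integral_const_mul,
      integral_chan_wallNormal h₁ h₃ (Z := fun y => deriv ψ y ^ 2)
        ((continuous_deriv_of_smooth hψ.smooth).pow 2)] at this
    have h01 := mul_le_mul_of_nonneg_left (hsumw Dw 0 1) hP
    linarith
  have hB : -∫ x, (1 - deriv ψ (x 1)) * U 1 x * (u 0 x - laminar 0 x) ∂(chan L₁ L₃) ≤
      layerWeight ψ * (q * (∑ i, ∑ j, ∫ x, Dw i j x ^ 2 ∂(chan L₁ L₃)) +
        (1 / (4 * q)) * ∑ i, ∑ j, ∫ x, DW i j x ^ 2 ∂(chan L₁ L₃)) := by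
    have c1 : Continuous fun y => 1 - deriv ψ y :=
      continuous_const.sub (continuous_deriv_of_smooth hψ.smooth)
    have n1 : ∀ y, 0 ≤ 1 - deriv ψ y := fun y => by linarith [hψ1 y]
    have p1 := (hu 0).integral_weight_mul_sq_le c1 n1
    have p2 := (hUb 1).integral_weight_mul_sq_le c1 n1
    have eU : ∀ x, U 1 x - laminar 1 x = U 1 x := fun x => by simp [laminar]
    simp only [eU] at p2
    have k1 : Integrable (fun x => (1 - deriv ψ (x 1)) * U 1 x * (u 0 x - laminar 0 x))
      (chan L₁ L₃) := (memLp_continuous_mul (hU 1).1 cρ).integrable_mul mw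
    have k2 : Integrable (fun x => (1 - deriv ψ (x 1)) * (u 0 x - laminar 0 x) ^ 2)
        (chan L₁ L₃) := by
      have : Integrable (fun x => (1 - deriv ψ (x 1)) * (u 0 x - laminar 0 x) *
        (u 0 x - laminar 0 x)) (chan L₁ L₃) := (memLp_continuous_mul mw cρ).integrable_mul mw
      simpa only [pow_two, mul_assoc] using this
    have k3 : Integrable (fun x => (1 - deriv ψ (x 1)) * U 1 x ^ 2) (chan L₁ L₃) := by
      have : Integrable (fun x => (1 - deriv ψ (x 1)) * U 1 x * U 1 x) (chan L₁ L₃) :=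
        (memLp_continuous_mul (hU 1).1 cρ).integrable_mul (hU 1).1
      simpa only [pow_two, mul_assoc] using this
    have hpt : ∀ x, -((1 - deriv ψ (x 1)) * U 1 x * (u 0 x - laminar 0 x)) ≤
        q * ((1 - deriv ψ (x 1)) * (u 0 x - laminar 0 x) ^ 2) +
          1 / (4 * q) * ((1 - deriv ψ (x 1)) * U 1 x ^ 2) := by
      intro x
      -- Young's inequality as a completed square; multiplying by the weight uses ψ' ≤ 1.
      have : 0 ≤ (1 - deriv ψ (x 1)) *
          (q * (u 0 x - laminar 0 x + U 1 x / (2 * q)) ^ 2) :=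
        mul_nonneg (n1 _) (mul_nonneg hq.le (sq_nonneg _))
      have e : (1 - deriv ψ (x 1)) * (q * (u 0 x - laminar 0 x + U 1 x / (2 * q)) ^ 2) =
          q * ((1 - deriv ψ (x 1)) * (u 0 x - laminar 0 x) ^ 2) +
          1 / (4 * q) * ((1 - deriv ψ (x 1)) * U 1 x ^ 2) +
          (1 - deriv ψ (x 1)) * U 1 x * (u 0 x - laminar 0 x) := by
        field_simp; ring
      linarith
    have := integral_mono k1.neg ((k2.const_mul q).add (k3.const_mul (1 / (4 * q)))) hpt
    simp only [Pi.neg_apply, Pi.add_apply, integral_neg] at this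
    rw [integral_add (k2.const_mul q) (k3.const_mul (1 / (4 * q))), integral_const_mul,
      integral_const_mul] at this
    have w0 : 0 ≤ layerWeight ψ := layerWeight_nonneg hψ1
    have q1 := mul_le_mul_of_nonneg_left
      (p1.trans (mul_le_mul_of_nonneg_left (hsumw Dw 0 1) w0)) hq.le
    have q2 := mul_le_mul_of_nonneg_left
      (p2.trans (mul_le_mul_of_nonneg_left (hsumw DW 1 1) w0))
      (show (0 : ℝ) ≤ 1 / (4 * q) by positivity)
    change _ ≤ q * (layerWeight ψ * _) at q1
    change _ ≤ 1 / (4 * q) * (layerWeight ψ * _) at q2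
    linarith
  have hA' := mul_le_mul_of_nonneg_left hA hν.le
  linarith

end Couette

/-! ### Long-time averages and the choice of background -/

namespace Couette

variable {L₁ L₃ : ℝ}

lemma ae_Ioi_of_forall_nat {p : ℝ → Prop}
    (h : ∀ n : ℕ, ∀ᵐ t ∂(volume.restrict (Ioc (0 : ℝ) ((n : ℝ) + 1))), p t) :
    ∀ᵐ t ∂(volume.restrict (Ioi (0 : ℝ))), p t := by
  have h' := ae_all_iff.2 fun n => (ae_restrict_iff' measurableSet_Ioc).1 (h n)
  refine (ae_restrict_iff' measurableSet_Ioi).2 ?_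
  filter_upwards [h'] with t ht hpos
  obtain ⟨n, hn⟩ := exists_nat_ge t
  exact ht n ⟨hpos, by linarith⟩

lemma MemL2LocL2.ae_memLp {f : ScalarField} (hf : MemL2LocL2 L₁ L₃ f) :
    ∀ᵐ t ∂(volume.restrict (Ioi (0 : ℝ))), MemLp (f t) 2 (chan L₁ L₃) := by
  refine ae_Ioi_of_forall_nat fun n => ?_
  have h := hf ((n : ℝ) + 1) (by positivity)
  filter_upwards [h.1.prodMk_left, h.integrable_sq.prod_right_ae] with t h1 h2
  exact (memLp_two_iff_integrable_sq h1).2 h2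

lemma MemL2LocH1.ae_memH1 {f : ScalarField} {g : Fin 3 → ScalarField}
    (h : MemL2LocH1 L₁ L₃ f g) :
    ∀ᵐ t ∂(volume.restrict (Ioi (0 : ℝ))), MemH1 L₁ L₃ (f t) (fun j => g j t) := by
  filter_upwards [h.1.ae_memLp, ae_all_iff.2 fun j => (h.2.1 j).ae_memLp, h.2.2] with t h1 h2 h3
  exact ⟨h1, h2, h3⟩

/-- The gradient energy accumulated over the time interval `(0, T]`. -/
noncomputable def gradEnergy (L₁ L₃ : ℝ) (Du : MatrixField) (T : ℝ) : ℝ :=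
  ∑ i, ∑ j, ∫ z, Du i j z.1 z.2 ^ 2 ∂((volume.restrict (Ioc (0 : ℝ) T)).prod (chan L₁ L₃))

lemma integrable_gradEnergy_slice {Du : MatrixField} (hDu : ∀ i j, MemL2LocL2 L₁ L₃ (Du i j))
    {T : ℝ} (hT : 0 < T) :
    IntegrableOn (fun t => ∑ i, ∑ j, ∫ x, Du i j t x ^ 2 ∂(chan L₁ L₃)) (Ioc 0 T) :=
  integrable_finsetSum _ fun i _ => integrable_finsetSum _ fun j _ =>
    (hDu i j T hT).integrable_sq.integral_prod_left

lemma gradEnergy_eq {Du : MatrixField} (hDu : ∀ i j, MemL2LocL2 L₁ L₃ (Du i j))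
    {T : ℝ} (hT : 0 < T) : gradEnergy L₁ L₃ Du T =
      ∫ t in Ioc (0 : ℝ) T, ∑ i, ∑ j, ∫ x, Du i j t x ^ 2 ∂(chan L₁ L₃) := by
  rw [integral_finsetSum _ fun i _ => integrable_finsetSum _ fun j _ =>
    (hDu i j T hT).integrable_sq.integral_prod_left]
  refine Finset.sum_congr rfl fun i _ => ?_
  rw [integral_finsetSum _ fun j _ => (hDu i j T hT).integrable_sq.integral_prod_left]
  exact Finset.sum_congr rfl fun j _ => integral_prod _ (hDu i j T hT).integrable_sq

lemma mul_le_gradEnergy (h₁ : 0 < L₁) (h₃ : 0 < L₃) {u : VectorField} {Du : MatrixField}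
    (hDu : ∀ i j, MemL2LocL2 L₁ L₃ (Du i j)) (hb : HasCouetteBoundaryValues L₁ L₃ u Du)
    {T : ℝ} (hT : 0 < T) : T * (L₁ * L₃) ≤ gradEnergy L₁ L₃ Du T := by
  rw [gradEnergy_eq hDu hT]
  have : ∫ _ in Ioc (0 : ℝ) T, L₁ * L₃ = T * (L₁ * L₃) := by simp [hT.le]
  rw [← this]
  refine integral_mono_ae (integrable_const _) (integrable_gradEnergy_slice hDu hT) ?_
  filter_upwards [ae_restrict_of_ae_restrict_of_subset Ioc_subset_Ioi_self hb] with t ht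
  have h := sum_integral_sq_sub h₁ h₃ ht
  have : 0 ≤ ∑ i, ∑ j, ∫ x, (Du i j t x - laminarGrad i j) ^ 2 ∂(chan L₁ L₃) :=
    Finset.sum_nonneg fun i _ => Finset.sum_nonneg fun j _ => integral_nonneg fun x => sq_nonneg _
  linarith

/-- The time-integrated energy inequality of the background method. -/
lemma IsCouettePair.exists_energy_le (h₁ : 0 < L₁) (h₃ : 0 < L₃) {ν : ℝ} (hν : 0 < ν)
    {U u : VectorField} {DU Du : MatrixField} (h : IsCouettePair L₁ L₃ ν U DU u Du) {ψ : ℝ → ℝ}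
    (hψ : IsProfile ψ) (hψ1 : ∀ y, deriv ψ y ≤ 1) {P c q w I : ℝ} (hP : 0 ≤ P) (hc : 0 ≤ c)
    (hq : 0 < q) (hPc : ∀ y z : ℝ, -(deriv ψ y * z) ≤ P * z ^ 2 + c * deriv ψ y ^ 2)
    (hw : layerWeight ψ ≤ w) (hI : ∫ y in (-1 / 2 : ℝ)..(1 / 2), deriv ψ y ^ 2 ≤ I) :
    ∃ C, ∀ T, 0 < T →
      ν * (1 - P) * (gradEnergy L₁ L₃ Du T - T * (L₁ * L₃)) ≤
        C + ν * c * I * (T * (L₁ * L₃)) +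
        w * (q * (gradEnergy L₁ L₃ Du T - T * (L₁ * L₃)) +
          (1 / (4 * q)) * (gradEnergy L₁ L₃ DU T - T * (L₁ * L₃))) := by
  obtain ⟨hadv, hsol, -⟩ := h
  obtain ⟨M, hM⟩ := hadv.bounded
  obtain ⟨d, D2, p, Dp, hd, hD2, hp, hmom⟩ := hsol.momentum
  have hDu : ∀ i j, MemL2LocL2 L₁ L₃ (Du i j) := fun i j => (hsol.memL2LocH1 i).2.1 j
  have hDU : ∀ i j, MemL2LocL2 L₁ L₃ (DU i j) := fun i j => (hadv.memL2LocH1 i).2.1 j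
  have mshift : ∀ i, MemLp (shift ψ i) 2 (chan L₁ L₃) := fun i =>
    memLp_of_continuous (continuous_shift hψ.smooth.continuous i) 2
  have htime := fun i => exists_neg_le_integral_timeDeriv_mul h₁ h₃ (hsol.memL2LocH1 i).1
    (hd i).1 (hd i).2 (mshift i)
  choose C hC using htime
  -- Both deviation energies are nonnegative, which allows the layer weight to be replaced by w. The
  -- result is affine in the gradient energies and in the work of ∂ₜu, hence ready to be integrated
  -- over (0, T].
  have hslice : ∀ᵐ t ∂(volume.restrict (Ioi (0 : ℝ))),
      0 ≤ (w * q - ν * (1 - P)) * (∑ i, ∑ j, ∫ x, Du i j t x ^ 2 ∂(chan L₁ L₃)) +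
        w * (1 / (4 * q)) * (∑ i, ∑ j, ∫ x, DU i j t x ^ 2 ∂(chan L₁ L₃)) -
        (∑ i, ∫ x, d i t x * (u i t x + shift ψ i x) ∂(chan L₁ L₃)) +
        (ν * (1 - P) + ν * c * I - w * q - w * (1 / (4 * q))) * (L₁ * L₃) := by
    have hM' := ae_all_iff.2 fun i => Measure.ae_ae_of_ae_prod (hM i)
    have hmom' := ae_all_iff.2 fun i => Measure.ae_ae_of_ae_prod (hmom i)
    filter_upwards [ae_all_iff.2 fun i => (hadv.memL2LocH1 i).ae_memH1, hM',
      Measure.ae_ae_of_ae_prod hadv.divFree, Measure.ae_ae_of_ae_prod hsol.divFree, hadv.boundary,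
      hsol.boundary, ae_all_iff.2 fun i => ae_all_iff.2 fun j => (hD2 i j).ae_memH1, hp.ae_memH1,
      hmom'] with t k1 k2 k3 k4 k5 k6 k7 k8 k9
    have key := background_inequality h₁ h₃ hν hψ hψ1 hP hq hPc (U := fun i => U i t)
      (u := fun i => u i t) (d := fun i => d i t) (Dp := fun i => Dp i t)
      (DU := fun i j => DU i j t) (Du := fun i j => Du i j t) (D2 := fun i j k => D2 i j k t)
      (p := p t) k1 k2 k3 k4 k5 k6 k7 k8 k9
    have n : ∀ G : Fin 3 → Fin 3 → Space → ℝ, 0 ≤ ∑ i, ∑ j, ∫ x, G i j x ^ 2 ∂(chan L₁ L₃) :=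
      fun G => Finset.sum_nonneg fun i _ => Finset.sum_nonneg fun j _ =>
        integral_nonneg fun x => sq_nonneg _
    have n1 := n fun i j x => Du i j t x - laminarGrad i j
    have n2 := n fun i j x => DU i j t x - laminarGrad i j
    rw [sum_integral_sq_sub h₁ h₃ k6] at n1
    rw [sum_integral_sq_sub h₁ h₃ k5] at n2
    have hV : 0 < L₁ * L₃ := mul_pos h₁ h₃
    have s1 : ν * c * (L₁ * L₃ * ∫ y in (-1 / 2 : ℝ)..(1 / 2), deriv ψ y ^ 2) ≤
        ν * c * (L₁ * L₃ * I) := by gcongr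
    have s2 := mul_le_mul_of_nonneg_right hw
      (add_nonneg (mul_nonneg hq.le n1) (mul_nonneg (show (0 : ℝ) ≤ 1 / (4 * q) by positivity) n2))
    linarith
  refine ⟨∑ i, C i, fun T hT => ?_⟩
  have hdv : ∀ i, Integrable (fun z : ℝ × Space => d i z.1 z.2 * (u i z.1 z.2 + shift ψ i z.2))
      ((volume.restrict (Ioc (0 : ℝ) T)).prod (chan L₁ L₃)) := fun i =>
    ((hd i).1 T hT).integrable_mul
      (((hsol.memL2LocH1 i).1 T hT).add (memLp_comp_snd (mshift i)))
  have j1 := (integrable_gradEnergy_slice hDu hT).const_mul (w * q - ν * (1 - P))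
  have j2 := (integrable_gradEnergy_slice hDU hT).const_mul (w * (1 / (4 * q)))
  have j3 : IntegrableOn (fun t => ∑ i, ∫ x, d i t x * (u i t x + shift ψ i x) ∂(chan L₁ L₃))
    (Ioc 0 T) := integrable_finsetSum _ fun i _ => (hdv i).integral_prod_left
  have hint := integral_nonneg_of_ae (μ := volume.restrict (Ioc (0 : ℝ) T))
    (ae_restrict_of_ae_restrict_of_subset (show Ioc (0 : ℝ) T ⊆ Ioi 0 from Ioc_subset_Ioi_self)
      hslice)
  rw [integral_add, integral_sub, integral_add j1 j2, integral_const_mul, integral_const_mul,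
    ← gradEnergy_eq hDu hT, ← gradEnergy_eq hDU hT, integral_finsetSum _
    fun i _ => (hdv i).integral_prod_left] at hint
  rotate_left
  · exact j1.add j2
  · exact j3
  · exact (j1.add j2).sub j3
  · exact integrable_const _
  have hlow : -∑ i, C i ≤ ∑ i, ∫ t in Ioc (0 : ℝ) T, ∫ x, d i t x * (u i t x + shift ψ i x)
      ∂(chan L₁ L₃) := by
    rw [← Finset.sum_neg_distrib]
    refine Finset.sum_le_sum fun i _ => (hC i T hT).trans (le_of_eq ?_)
    exact integral_prod _ (hdv i)
  have hconst : ∫ _ in Ioc (0 : ℝ) T, (ν * (1 - P) + ν * c * I - w * q - w * (1 / (4 * q))) *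
      (L₁ * L₃) = T * ((ν * (1 - P) + ν * c * I - w * q - w * (1 / (4 * q))) * (L₁ * L₃)) := by
    simp [hT.le]
  rw [hconst] at hint
  linarith

lemma volume_cell (h₁ : 0 < L₁) (h₃ : 0 < L₃) :
    volume (cell L₁ L₃) = ENNReal.ofReal (L₁ * L₃) := by
  have h := integral_one_chan h₁ h₃
  rw [integral_const, smul_eq_mul, mul_one, chan, measureReal_restrict_apply_univ] at h
  rw [← h, Measure.real, ENNReal.ofReal_toReal isCompact_cell.measure_lt_top.ne]

lemma average_eq_ofReal (h₁ : 0 < L₁) (h₃ : 0 < L₃) {Du : MatrixField}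
    (hDu : ∀ i j, MemL2LocL2 L₁ L₃ (Du i j)) {T : ℝ} (hT : 0 < T) :
    (ENNReal.ofReal T)⁻¹ * ∫⁻ t in Ioc (0 : ℝ) T, (volume (cell L₁ L₃))⁻¹ *
      ∫⁻ x in cell L₁ L₃, ENNReal.ofReal (∑ i, ∑ j, Du i j t x ^ 2) =
      ENNReal.ofReal (gradEnergy L₁ L₃ Du T / (T * (L₁ * L₃))) := by
  have hV : 0 < L₁ * L₃ := mul_pos h₁ h₃
  have hi : ∀ i, Integrable (fun z : ℝ × Space => ∑ j, Du i j z.1 z.2 ^ 2)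
      ((volume.restrict (Ioc (0 : ℝ) T)).prod (chan L₁ L₃)) := fun i =>
    integrable_finsetSum _ fun j _ => (hDu i j T hT).integrable_sq
  have hint : Integrable (fun z : ℝ × Space => ∑ i, ∑ j, Du i j z.1 z.2 ^ 2)
      ((volume.restrict (Ioc (0 : ℝ) T)).prod (chan L₁ L₃)) :=
    integrable_finsetSum _ fun i _ => hi i
  have hE : gradEnergy L₁ L₃ Du T = ∫ z, ∑ i, ∑ j, Du i j z.1 z.2 ^ 2
      ∂((volume.restrict (Ioc (0 : ℝ) T)).prod (chan L₁ L₃)) := by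
    rw [integral_finsetSum _ fun i _ => hi i]
    exact Finset.sum_congr rfl fun i _ =>
      (integral_finsetSum _ fun j _ => (hDu i j T hT).integrable_sq).symm
  have hfub := lintegral_prod (μ := volume.restrict (Ioc (0 : ℝ) T)) (ν := chan L₁ L₃) _
    hint.aemeasurable.ennreal_ofReal
  rw [← ofReal_integral_eq_lintegral_ofReal hint (Eventually.of_forall fun z =>
    Finset.sum_nonneg fun i _ => Finset.sum_nonneg fun j _ => sq_nonneg _), ← hE] at hfub
  rw [volume_cell h₁ h₃, lintegral_const_mul' _ _ (ENNReal.inv_ne_top.2 (by simpa using hV))]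
  change _ * (_ * ∫⁻ t in Ioc (0 : ℝ) T, ∫⁻ x, ENNReal.ofReal (∑ i, ∑ j, Du i j t x ^ 2)
    ∂(chan L₁ L₃)) = _
  rw [← hfub, ← ENNReal.ofReal_inv_of_pos hT, ← ENNReal.ofReal_inv_of_pos hV,
    ← ENNReal.ofReal_mul (by positivity), ← ENNReal.ofReal_mul (by positivity)]
  congr 1
  field_simp

lemma dissipation_eq_limsup (h₁ : 0 < L₁) (h₃ : 0 < L₃) {ν : ℝ} (hν : 0 < ν) {Du : MatrixField}
    (hDu : ∀ i j, MemL2LocL2 L₁ L₃ (Du i j)) :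
    dissipation L₁ L₃ ν Du = limsup (fun T : ℝ =>
      ENNReal.ofReal (ν * (gradEnergy L₁ L₃ Du T / (T * (L₁ * L₃))))) atTop := by
  rw [dissipation, longTimeAverage, ← ENNReal.limsup_const_mul_of_ne_top ENNReal.ofReal_ne_top]
  refine limsup_congr ?_
  filter_upwards [eventually_gt_atTop 0] with T hT
  rw [average_eq_ofReal h₁ h₃ hDu hT, ENNReal.ofReal_mul hν.le]

/-- An affine inequality between time averages passes to their limits superior. -/
lemma limsup_ofReal_le_affine {f g : ℝ → ℝ} {a b C : ℝ} (hb : 0 ≤ b)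
    (h : ∀ T, 0 < T → f T ≤ C / T + a + b * g T)
    (hg : limsup (fun T => ENNReal.ofReal (g T)) atTop ≠ ⊤) :
    limsup (fun T => ENNReal.ofReal (f T)) atTop ≤
      ENNReal.ofReal (a + b * (limsup (fun T => ENNReal.ofReal (g T)) atTop).toReal) := by
  set E := (limsup (fun T => ENNReal.ofReal (g T)) atTop).toReal with hE
  -- The slack ε turns the limit superior of g into an eventual strict bound and absorbs C / T; it
  -- is sent to 0 at the end.
  have hε : ∀ ε : ℝ, 0 < ε → limsup (fun T => ENNReal.ofReal (f T)) atTop ≤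
      ENNReal.ofReal (ε + a + b * (E + ε)) := by
    intro ε hε
    have hlt : limsup (fun T => ENNReal.ofReal (g T)) atTop < ENNReal.ofReal (E + ε) := by
      rw [← ENNReal.ofReal_toReal hg]
      exact (ENNReal.ofReal_lt_ofReal_iff (by positivity)).2 (by linarith)
    have e1 := eventually_lt_of_limsup_lt hlt
    have e2 : ∀ᶠ T : ℝ in atTop, C / T < ε :=
      (tendsto_const_nhds.div_atTop tendsto_id).eventually (gt_mem_nhds hε)
    refine limsup_le_of_le (by isBoundedDefault) ?_
    filter_upwards [e1, e2, eventually_gt_atTop 0] with T k1 k2 k3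
    refine ENNReal.ofReal_le_ofReal ?_
    have k4 : g T ≤ E + ε := ((ENNReal.ofReal_lt_ofReal_iff (by positivity)).1 k1).le
    have := h T k3
    have := mul_le_mul_of_nonneg_left k4 hb
    linarith
  have ht : Tendsto (fun ε : ℝ => ENNReal.ofReal (ε + a + b * (E + ε))) (𝓝[>] 0)
      (𝓝 (ENNReal.ofReal (0 + a + b * (E + 0)))) := by
    refine (ENNReal.continuous_ofReal.tendsto _).comp ?_
    have : Continuous fun ε : ℝ => ε + a + b * (E + ε) := by fun_prop
    exact (this.tendsto 0).mono_left nhdsWithin_le_nhds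
  rw [zero_add, add_zero] at ht
  exact ge_of_tendsto ht (eventually_nhdsWithin_of_forall fun ε hε' => hε ε hε')

/-- The bound on the dissipation given by a background profile. -/
lemma IsCouettePair.dissipation_le (h₁ : 0 < L₁) (h₃ : 0 < L₃) {ν : ℝ} (hν : 0 < ν)
    {U u : VectorField} {DU Du : MatrixField} (h : IsCouettePair L₁ L₃ ν U DU u Du) {ψ : ℝ → ℝ}
    (hψ : IsProfile ψ) (hψ1 : ∀ y, deriv ψ y ≤ 1) {P c q w I : ℝ} (hP : 0 ≤ P) (hc : 0 ≤ c)
    (hq : 0 < q) (hPc : ∀ y z : ℝ, -(deriv ψ y * z) ≤ P * z ^ 2 + c * deriv ψ y ^ 2)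
    (hw : layerWeight ψ ≤ w) (hI : ∫ y in (-1 / 2 : ℝ)..(1 / 2), deriv ψ y ^ 2 ≤ I)
    (hbal : ν * (1 - P) - w * q = ν / 2) (hfin : dissipation L₁ L₃ ν DU ≠ ⊤) :
    dissipation L₁ L₃ ν Du ≤ ENNReal.ofReal (ν + 2 * (ν * c * I) +
      w / (2 * q * ν) * ((dissipation L₁ L₃ ν DU).toReal - ν)) := by
  obtain ⟨C, hC⟩ := h.exists_energy_le h₁ h₃ hν hψ hψ1 hP hc hq hPc hw hI
  have hw0 : 0 ≤ w := (layerWeight_nonneg hψ1).trans hw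
  have hV : 0 < L₁ * L₃ := mul_pos h₁ h₃
  rw [dissipation_eq_limsup h₁ h₃ hν fun i j => (h.advecting.memL2LocH1 i).2.1 j] at hfin ⊢
  rw [dissipation_eq_limsup h₁ h₃ hν fun i j => (h.solution.memL2LocH1 i).2.1 j]
  refine (limsup_ofReal_le_affine (a := ν + 2 * (ν * c * I) - w / (2 * q * ν) * ν)
    (b := w / (2 * q * ν)) (C := 2 * C / (L₁ * L₃)) (by positivity) (fun T hT => ?_) hfin).trans
    (ENNReal.ofReal_le_ofReal (le_of_eq (by ring)))
  have key := hC T hT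
  set A := gradEnergy L₁ L₃ Du T
  set B := gradEnergy L₁ L₃ DU T
  have hTV : 0 < T * (L₁ * L₃) := mul_pos hT hV
  -- By `hbal`, exactly half of the viscous term survives the cross term (P) and the convective term
  -- (wq).
  have key2 : ν / 2 * (A - T * (L₁ * L₃)) ≤ C + ν * c * I * (T * (L₁ * L₃)) +
      w * (1 / (4 * q)) * (B - T * (L₁ * L₃)) := by
    rw [← hbal]; linarith
  have e : 2 * C / (L₁ * L₃) / T + (ν + 2 * (ν * c * I) - w / (2 * q * ν) * ν) +
      w / (2 * q * ν) * (ν * (B / (T * (L₁ * L₃)))) - ν * (A / (T * (L₁ * L₃))) =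
      2 / (T * (L₁ * L₃)) * (C + ν * c * I * (T * (L₁ * L₃)) +
      w * (1 / (4 * q)) * (B - T * (L₁ * L₃)) - ν / 2 * (A - T * (L₁ * L₃))) := by
    field_simp; ring
  have : 0 ≤ 2 / (T * (L₁ * L₃)) * (C + ν * c * I * (T * (L₁ * L₃)) +
      w * (1 / (4 * q)) * (B - T * (L₁ * L₃)) - ν / 2 * (A - T * (L₁ * L₃))) :=
    mul_nonneg (by positivity) (by linarith)
  linarith

/-- The laminar flow minimises the gradient energy for these boundary values. This makes ε_U
positive and comparable with ν in the choice of background. -/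
lemma le_dissipation (h₁ : 0 < L₁) (h₃ : 0 < L₃) {ν : ℝ} (hν : 0 < ν) {U : VectorField}
    {DU : MatrixField} (h : IsAdvectingField L₁ L₃ U DU) :
    ENNReal.ofReal ν ≤ dissipation L₁ L₃ ν DU := by
  have hDU : ∀ i j, MemL2LocL2 L₁ L₃ (DU i j) := fun i j => (h.memL2LocH1 i).2.1 j
  rw [dissipation_eq_limsup h₁ h₃ hν hDU, ← limsup_const (f := (atTop : Filter ℝ))
    (ENNReal.ofReal ν)]
  refine limsup_le_limsup ?_
  filter_upwards [eventually_gt_atTop 0] with T hT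
  refine ENNReal.ofReal_le_ofReal ?_
  have := mul_le_gradEnergy h₁ h₃ hDU h.boundary hT
  have hTV : 0 < T * (L₁ * L₃) := mul_pos hT (mul_pos h₁ h₃)
  exact le_mul_of_one_le_right hν.le ((one_le_div hTV).2 this)

lemma IsCouettePair.dissipation_le_rpow (h₁ : 0 < L₁) (h₃ : 0 < L₃) {ν : ℝ} (hν : 0 < ν)
    (hν8 : ν ≤ 8) {U u : VectorField} {DU Du : MatrixField}
    (h : IsCouettePair L₁ L₃ ν U DU u Du) :
    dissipation L₁ L₃ ν Du ≤ 4 * dissipation L₁ L₃ ν DU ^ (1 / 3 : ℝ) := by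
  by_cases hfin : dissipation L₁ L₃ ν DU = ⊤
  · rw [hfin, ENNReal.top_rpow_of_pos (by norm_num), ENNReal.mul_top (by norm_num)]
    exact le_top
  set E := (dissipation L₁ L₃ ν DU).toReal with hE
  have hEν : ν ≤ E := by
    have := ENNReal.toReal_mono hfin (le_dissipation h₁ h₃ hν h.advecting)
    rwa [ENNReal.toReal_ofReal hν.le] at this
  have hE0 : 0 < E := hν.trans_le hEν
  have cube : ∀ x : ℝ, 0 < x → (x ^ (1 / 3 : ℝ)) ^ 3 = x := fun x hx => by
    rw [← Real.rpow_natCast, ← Real.rpow_mul hx.le]; norm_num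
  set s := E ^ (1 / 3 : ℝ) with hs
  have hs0 : 0 < s := Real.rpow_pos_of_pos hE0 _
  have hs3 : s ^ 3 = E := cube E hE0
  have hgoal : 4 * dissipation L₁ L₃ ν DU ^ (1 / 3 : ℝ) = ENNReal.ofReal (4 * s) := by
    rw [← ENNReal.ofReal_toReal hfin, ← hE, ENNReal.ofReal_rpow_of_pos hE0,
      ENNReal.ofReal_mul (by norm_num), ENNReal.ofReal_ofNat]
  rw [hgoal]
  rcases le_or_gt s (4 * ν) with hcase | hcase
  -- Laminar background: the weight is ∫(1/2 - |y|) = 1/4, and q = 2ν gives wq = ν/2. The bound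
  -- becomes ν + (E - ν)/(16ν²).
  · have hz : IsProfile fun _ => 0 := ⟨contDiff_const, 0, by norm_num, fun y hy => absurd rfl hy⟩
    refine (h.dissipation_le h₁ h₃ hν hz (by simp) (P := 0) (c := 0) (q := 2 * ν) (w := 1 / 4)
      (I := 0) le_rfl le_rfl (by positivity) (by simp)
      (by simp [layerWeight, -one_div, integral_half_sub_abs]) (by simp) (by ring) hfin).trans
      (ENNReal.ofReal_le_ofReal ?_)
    rw [← hE]
    -- Factoring E - ν = s³ - p³ and using s ≤ 4ν bounds the second term by 3(s - p). Since ν ≤ 8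
    -- means p ≤ 2, also ν = p³ ≤ 4p, and the total is at most p + 3s ≤ 4s.
    set p := ν ^ (1 / 3 : ℝ) with hp
    have hp0 : 0 < p := Real.rpow_pos_of_pos hν _
    have hp3 : p ^ 3 = ν := cube ν hν
    have hps : p ≤ s := Real.rpow_le_rpow hν.le hEν (by norm_num)
    have hp2 : p ≤ 2 := by
      by_contra hlt
      have : 2 ^ 3 < p ^ 3 := pow_lt_pow_left₀ (not_le.1 hlt) (by norm_num) (by norm_num)
      linarith
    have hν4 : ν ≤ 4 * p := by
      have : 0 ≤ p * ((2 - p) * (2 + p)) := by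
        have : 0 ≤ 2 - p := by linarith
        positivity
      nlinarith
    have hcub : E - ν ≤ (s - p) * (48 * ν ^ 2) := by
      have h1 : s ^ 2 + s * p + p ^ 2 ≤ 3 * s ^ 2 := by nlinarith
      have h2 : s ^ 2 ≤ (4 * ν) ^ 2 := pow_le_pow_left₀ hs0.le hcase 2
      have h3 : E - ν = (s - p) * (s ^ 2 + s * p + p ^ 2) := by rw [← hs3, ← hp3]; ring
      rw [h3]
      exact mul_le_mul_of_nonneg_left (by nlinarith) (by linarith)
    have e : (1 / 4 : ℝ) / (2 * (2 * ν) * ν) * (E - ν) = (E - ν) / (16 * ν ^ 2) := by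
      field_simp; ring
    have : (E - ν) / (16 * ν ^ 2) ≤ 3 * (s - p) := by
      rw [div_le_iff₀ (by positivity)]; linarith
    rw [e]
    linarith
  · have hδ0 : 0 < ν / s := div_pos hν hs0
    have hδ1 : ν / s ≤ 1 / 4 := by rw [div_le_iff₀ hs0]; linarith
    obtain ⟨ψ, k1, k2, k3, k4, k5⟩ := exists_boundary_layer hδ0 hδ1
    -- P = 1/4 and c = 1 come from the square (z/2 + ψ')², and q is fixed by wq = ν/4. Here ν < s/4,
    -- so the resulting terms 3ν, (5/2)s and (2601/5000)s add up to less than 4s.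
    refine (h.dissipation_le h₁ h₃ hν ⟨k1, k2⟩ k3 (P := 1 / 4) (c := 1)
      (q := ν / (4 * (51 / 100 * (ν / s)))) (by norm_num) zero_le_one (by positivity)
      (fun y z => by nlinarith [sq_nonneg (z / 2 + deriv ψ y)]) k5 k4
      (by field_simp; norm_num) hfin).trans (ENNReal.ofReal_le_ofReal ?_)
    rw [← hE]
    have e : ν + 2 * (ν * 1 * (1 + 5 / 4 / (ν / s))) + 51 / 100 * (ν / s) /
        (2 * (ν / (4 * (51 / 100 * (ν / s)))) * ν) * (E - ν) =
        3 * ν + 5 / 2 * s + 2601 / 5000 * ((E - ν) / s ^ 2) := by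
      field_simp; ring
    have : (E - ν) / s ^ 2 ≤ s := by
      rw [div_le_iff₀ (by positivity), ← hs3]; nlinarith
    rw [e]
    linarith

end Couette

/-! ### The two claims -/

theorem mainTheorem2 :
    (∀ (L₁ L₃ : ℝ), 0 < L₁ → 0 < L₃ → ∀ ν : ℝ, 0 < ν → ν ≤ 8 →
      ∀ (U : Couette.VectorField) (DU : Couette.MatrixField)
        (u : Couette.VectorField) (Du : Couette.MatrixField),
        Couette.IsCouettePair L₁ L₃ ν U DU u Du →
          Couette.dissipation L₁ L₃ ν Du ≤
            4 * Couette.dissipation L₁ L₃ ν DU ^ (1 / 3 : ℝ)) ∧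
    (∀ (α β c₁ c₂ : ℝ), 0 < c₁ → 0 < c₂ → ∃ c : ℝ, 0 < c ∧
      ∀ (L₁ L₃ : ℝ), 0 < L₁ → 0 < L₃ → ∀ ν₀ : ℝ, 0 < ν₀ → ν₀ ≤ 1 →
      ∀ (U : ℝ → Couette.VectorField) (DU : ℝ → Couette.MatrixField)
        (u : ℝ → Couette.VectorField) (Du : ℝ → Couette.MatrixField),
        (∀ ν ∈ Set.Ioo 0 ν₀, Couette.IsCouettePair L₁ L₃ ν (U ν) (DU ν) (u ν) (Du ν)) →
        (∀ ν ∈ Set.Ioo 0 ν₀,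
          ENNReal.ofReal (c₁ * (ν ^ α * Real.log ν⁻¹ ^ β)) ≤
              Couette.dissipation L₁ L₃ ν (DU ν) ∧
            Couette.dissipation L₁ L₃ ν (DU ν) ≤
              ENNReal.ofReal (c₂ * (ν ^ α * Real.log ν⁻¹ ^ β))) →
        ∀ ν ∈ Set.Ioo 0 ν₀,
          Couette.dissipation L₁ L₃ ν (Du ν) ≤
            ENNReal.ofReal (c * (ν ^ (α / 3) * Real.log ν⁻¹ ^ (β / 3)))) := by
  refine ⟨fun L₁ L₃ h₁ h₃ ν hν hν8 U DU u Du h => h.dissipation_le_rpow h₁ h₃ hν hν8, ?_⟩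
  intro α β c₁ c₂ _ hc₂
  refine ⟨4 * c₂ ^ (1 / 3 : ℝ), by positivity, ?_⟩
  intro L₁ L₃ h₁ h₃ ν₀ _ hν₀ U DU u Du hpair hbd ν hν
  have hν0 : 0 < ν := hν.1
  -- ν < ν₀ ≤ 1 makes the logarithm positive, so its real powers multiply as expected.
  have hlog : 0 < Real.log ν⁻¹ := Real.log_pos ((one_lt_inv₀ hν0).2 (hν.2.trans_le hν₀))
  have hA : 0 < ν ^ α := Real.rpow_pos_of_pos hν0 _
  have hB : 0 < Real.log ν⁻¹ ^ β := Real.rpow_pos_of_pos hlog _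
  refine ((hpair ν hν).dissipation_le_rpow h₁ h₃ hν0 (by linarith [hν.2])).trans ?_
  calc 4 * Couette.dissipation L₁ L₃ ν (DU ν) ^ (1 / 3 : ℝ)
      ≤ 4 * ENNReal.ofReal (c₂ * (ν ^ α * Real.log ν⁻¹ ^ β)) ^ (1 / 3 : ℝ) := by
        gcongr
        exact (hbd ν hν).2
    _ = ENNReal.ofReal (4 * c₂ ^ (1 / 3 : ℝ) * (ν ^ (α / 3) * Real.log ν⁻¹ ^ (β / 3))) := by
        rw [ENNReal.ofReal_rpow_of_pos (by positivity), Real.mul_rpow hc₂.le (by positivity),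
          Real.mul_rpow hA.le hB.le, ← Real.rpow_mul hν0.le, ← Real.rpow_mul hlog.le,
          mul_one_div, mul_one_div, mul_assoc, ENNReal.ofReal_mul (p := 4) (by norm_num),
          ENNReal.ofReal_ofNat]
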